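/- Let $X$ be a Calabi–Yau threefold, that is, a smooth proper irreducible variety over $\mathbb C$ of dimension $3$ whose canonical (dualizing) sheaf is trivial, $\omega_X\cong\mathcal O_X$, and with $H^1(X,\mathcal O_X)=H^2(X,\mathcal O_X)=0$. Let $p\in X$ be a closed point, $\mathcal O_p$ its skyscraper sheaf and $\mathcal I_p=\ker(\mathcal O_X\to\mathcal O_p)$ its ideal sheaf. For an object $\mathcal F^\bullet$ of the derived category put $$T(\mathcal F^\bullet)=\operatorname{Cone}\bigl(R\mathrm{Hom}(\mathcal O_X,\mathcal F^\bullet)\otimes_{\mathbb C}\mathcal O_X\to\mathcal F^\bullet\bigr),$$ the cone of the evaluation map, and let $\operatorname{Hom}^P(\mathcal O_X,\mathcal F^\bullet)$ be the degree $P$ cohomology of $R\mathrm{Hom}(\mathcal O_X,\mathcal F^\bullet)$. A sheaf is regarded as a complex in degree $0$, and "quasi-isomorphic" means isomorphic in the derived category. Then: 1. $T(\mathcal O_p)$ is quasi-isomorphic to the two-term complex $\mathcal O_X\to\mathcal O_p$ with $\mathcal O_p$ in degree $0$, and hence to $\mathcal I_p[1]$. 2. $H^3(X,\mathcal I_p)\cong\mathbb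 C$, and $H^i(X,\mathcal I_p)=0$ for all $i\neq 3$. 3. $T(T(\mathcal O_p))$ is the cone of a nonzero morphism $\mathcal O_X[-2]\to\mathcal I_p[1]$. Its cohomology sheaves are $\mathcal I_p$ in degree $-1$, $\mathcal O_X$ in degree $1$, and $0$ in all other degrees. 4. For some integer $P$, the vector spaces $\operatorname{Hom}^P(\mathcal O_X,T(T(\mathcal O_p)))$ and $\operatorname{Hom}^P(\mathcal O_X,\mathcal I_p[1]\oplus\mathcal O_X[-1])$ are not isomorphic. In particular, $T(T(\mathcal O_p))$ is not quasi-isomorphic to the direct sum $\mathcal I_p[1]\oplus\mathcal O_X[-1]$ of its shifted cohomology sheaves. -/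

import Mathlib

open CategoryTheory Limits AlgebraicGeometry

universe w

noncomputable section

/-! ## Enough injectives in the category of `𝒪_X`-modules -/

namespace CalabiYauTwist

theorem hasExactColimitsOfShape_presheafOfModules {C : Type} [SmallCategory C]
    (R : Cᵒᵖ ⥤ RingCat.{0}) (J : Type) [SmallCategory J] [IsFiltered J] :
    HasExactColimitsOfShape J (PresheafOfModules.{0} R) := by
  have : ReflectsFiniteLimits (PresheafOfModules.toPresheaf.{0} R) :=
    ⟨fun _ _ _ => reflectsLimitsOfShape_of_reflectsIsomorphisms⟩
  exact HasExactColimitsOfShape.domain_of_functor J (PresheafOfModules.toPresheaf.{0} R)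

theorem isGrothendieckAbelian_modules (X : Scheme.{0}) :
    IsGrothendieckAbelian.{0} X.Modules := by
  let adj := PresheafOfModules.sheafificationAdjunction (𝟙 X.ringCatSheaf.obj)
  have h5 : AB5OfSize.{0, 0} (SheafOfModules.{0} X.ringCatSheaf) :=
    ⟨fun J _ _ => by
      have := hasExactColimitsOfShape_presheafOfModules X.ringCatSheaf.obj J
      exact adj.hasExactColimitsOfShape J⟩
  have hs : HasSeparator (SheafOfModules.{0} X.ringCatSheaf) := by
    have hsep : ObjectProperty.IsSeparating (.ofObj fun U : X.Opens =>
        (PresheafOfModules.sheafification (𝟙 X.ringCatSheaf.obj)).obj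
          ((yoneda ⋙ PresheafOfModules.free X.ringCatSheaf.obj).obj U)) := by
      intro F G f g hfg
      apply (SheafOfModules.forget X.ringCatSheaf).map_injective
      refine PresheafOfModules.freeYoneda.isSeparating _ _ _ ?_
      rintro _ ⟨U⟩ a
      apply (adj.homEquiv _ _).symm.injective
      have key := hfg _ (ObjectProperty.ofObj_apply _ U) ((adj.homEquiv _ _).symm a)
      exact (adj.homEquiv_naturality_right_symm a f).trans
        (key.trans (adj.homEquiv_naturality_right_symm a g).symm)
    exact ⟨_, hsep.isSeparator_coproduct⟩
  exact
    { locallySmall := inferInstanceAs (LocallySmall.{0} (SheafOfModules.{0} X.ringCatSheaf))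
      hasFilteredColimitsOfSize :=
        inferInstanceAs (HasFilteredColimitsOfSize.{0, 0} (SheafOfModules.{0} X.ringCatSheaf))
      ab5OfSize := h5
      hasSeparator := hs }

instance enoughInjectives_modules (X : Scheme.{0}) : EnoughInjectives X.Modules :=
  have := isGrothendieckAbelian_modules X
  IsGrothendieckAbelian.enoughInjectives.{0}

/-! ## Schemes over `ℂ`: global sections, cohomology, constant sheaves -/

/-- The structure sheaf `𝒪_X`, as an `𝒪_X`-module. -/
abbrev structureSheaf (X : Scheme.{0}) : X.Modules := SheafOfModules.unit X.ringCatSheaf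

section

variable {X : Scheme.{0}} (f : X ⟶ Spec (CommRingCat.of ℂ))

/-- The functor `M ↦ Γ(X, M) = Hom(𝒪_X, M)` from `𝒪_X`-modules to complex vector spaces, for a
scheme `f : X ⟶ Spec ℂ` over `ℂ`. It is computed as the global sections of `f_* M`, regarded as
a sheaf of modules on `Spec ℂ`. -/
def globalSections : X.Modules ⥤ ModuleCat.{0} ℂ :=
  Scheme.Modules.pushforward f ⋙ moduleSpecΓFunctor (R := CommRingCat.of ℂ)

/-- The functor `V ↦ V ⊗_ℂ 𝒪_X` from complex vector spaces to `𝒪_X`-modules: the pullback along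
`f : X ⟶ Spec ℂ` of the quasi-coherent sheaf on `Spec ℂ` associated with `V`. -/
def tensorStructureSheaf : ModuleCat.{0} ℂ ⥤ X.Modules :=
  tilde.functor (CommRingCat.of ℂ) ⋙ Scheme.Modules.pullback f

/-- The adjunction `Hom(V ⊗_ℂ 𝒪_X, M) ≃ Hom_ℂ(V, Hom(𝒪_X, M))`. Its counit is the evaluation
map `Hom(𝒪_X, M) ⊗_ℂ 𝒪_X ⟶ M`. -/
def tensorAdjunction : tensorStructureSheaf f ⊣ globalSections f :=
  tilde.adjunction.comp (Scheme.Modules.pullbackPushforwardAdjunction f)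

instance globalSections_additive : (globalSections f).Additive := by
  have : (globalSections f).IsRightAdjoint := (tensorAdjunction f).isRightAdjoint
  exact Functor.additive_of_preserves_binary_products _

instance tensorStructureSheaf_additive : (tensorStructureSheaf f).Additive :=
  (tensorAdjunction f).left_adjoint_additive

/-- Sheaf cohomology `Hⁱ(X, M)`, as a functor to complex vector spaces. -/
abbrev sheafCohomology (i : ℕ) : X.Modules ⥤ ModuleCat.{0} ℂ := (globalSections f).rightDerived i

/-! ## Calabi–Yau threefolds -/

/-- `ω`, together with the trace map `t : H^d(X, ω) ⟶ ℂ`, is a dualizing sheaf for the proper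
scheme `X` of dimension `d` over `ℂ`: `ω` is coherent and for every coherent sheaf `F` the pairing
`Hom(F, ω) × H^d(X, F) ⟶ H^d(X, ω) ⟶ ℂ` induces a bijection from `Hom(F, ω)` to the dual vector
space of `H^d(X, F)`. On a locally noetherian scheme, the coherent sheaves are the `𝒪_X`-modules
of finite presentation. -/
structure IsDualizingSheaf (d : ℕ) (ω : X.Modules)
    (t : (sheafCohomology f d).obj ω ⟶ ModuleCat.of ℂ ℂ) : Prop where
  coherent : SheafOfModules.IsFinitePresentation ω
  bijective_pairing (F : X.Modules) (hF : SheafOfModules.IsFinitePresentation F) :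
    Function.Bijective (fun φ : F ⟶ ω => (sheafCohomology f d).map φ ≫ t)

/-- A Calabi–Yau threefold: a smooth proper complex variety `f : X ⟶ Spec ℂ` of dimension `3`, with
trivial canonical (dualizing) sheaf and with `H¹(X, 𝒪_X) = H²(X, 𝒪_X) = 0`. -/
structure IsCalabiYauThreefold : Prop where
  isIntegral : IsIntegral X
  isProper : IsProper f
  smooth : SmoothOfRelativeDimension 3 f
  trivial_canonical : ∃ (ω : X.Modules) (t : (sheafCohomology f 3).obj ω ⟶ ModuleCat.of ℂ ℂ),
    IsDualizingSheaf f 3 ω t ∧ Nonempty (ω ≅ structureSheaf X)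
  isZero_H1 : IsZero ((sheafCohomology f 1).obj (structureSheaf X))
  isZero_H2 : IsZero ((sheafCohomology f 2).obj (structureSheaf X))

end

/-! ## The skyscraper sheaf and the ideal sheaf of a point -/

section

variable {X : Scheme.{0}} (p : X)

/-- The skyscraper sheaf `𝒪_p`: the direct image of the structure sheaf under
`Spec κ(p) ⟶ X`. -/
def skyscraper : X.Modules :=
  (Scheme.Modules.pushforward (X.fromSpecResidueField p)).obj
    (structureSheaf (Spec (X.residueField p)))

/-- The evaluation at `p`, as a morphism `𝒪_X ⟶ 𝒪_p`. -/
def evalAtPoint : structureSheaf X ⟶ skyscraper p :=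
  SheafOfModules.unitToPushforwardObjUnit (X.fromSpecResidueField p).toRingCatSheafHom

/-- The ideal sheaf `I_p` of the point `p`: the kernel of `𝒪_X ⟶ 𝒪_p`. -/
def idealSheaf : X.Modules := kernel (evalAtPoint p)

end

/-! ## The derived category and the twist -/

section

variable {X : Scheme.{0}} [HasDerivedCategory.{w} X.Modules]

theorem exists_injectiveResolution (K : DerivedCategory.Plus X.Modules) :
    ∃ L : CochainComplex.Plus (InjectiveObject X.Modules),
      Nonempty (DerivedCategory.Plus.Q.obj
        ((InjectiveObject.ι X.Modules).mapCochainComplexPlus.obj L) ≅ K) := by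
  obtain ⟨n, hn⟩ := K.property
  have : K.IsGE n := (DerivedCategory.Plus.isGE_ι_obj_iff K n).1 hn
  obtain ⟨L, _, h⟩ := DerivedCategory.Plus.exists_injective_nonempty_iso K n
  exact ⟨L, h⟩

/-- A bounded below complex of injective `𝒪_X`-modules representing the object `K` of the bounded
below derived category. -/
def injectiveResolution (K : DerivedCategory.Plus X.Modules) : CochainComplex.Plus X.Modules :=
  (InjectiveObject.ι X.Modules).mapCochainComplexPlus.obj (exists_injectiveResolution K).choose

end

section

variable {X : Scheme.{0}} (f : X ⟶ Spec (CommRingCat.of ℂ))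

/-- For a complex `I` of injective `𝒪_X`-modules, the complex of complex vector spaces
`hom^•(𝒪_X, I)`, with `hom^P(𝒪_X, I) = Hom(𝒪_X, I^P)`. -/
def homComplex (I : CochainComplex X.Modules ℤ) : CochainComplex (ModuleCat.{0} ℂ) ℤ :=
  ((globalSections f).mapHomologicalComplex _).obj I

/-- The evaluation map `hom^•(𝒪_X, I) ⊗_ℂ 𝒪_X ⟶ I`. -/
def evalComplex (I : CochainComplex X.Modules ℤ) :
    ((tensorStructureSheaf f).mapHomologicalComplex _).obj (homComplex f I) ⟶ I where
  f n := (tensorAdjunction f).counit.app (I.X n)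
  comm' i j _ := ((tensorAdjunction f).counit.naturality (I.d i j)).symm

/-- The cone of the evaluation map `hom^•(𝒪_X, I) ⊗_ℂ 𝒪_X ⟶ I`. -/
def coneEvalComplex (I : CochainComplex.Plus X.Modules) : CochainComplex.Plus X.Modules :=
  ⟨CochainComplex.mappingCone (evalComplex f I.obj), by
    obtain ⟨n, hn⟩ := I.property
    have : (homComplex f I.obj).IsStrictlyGE n := by
      dsimp only [homComplex]; infer_instance
    exact ⟨n - 1, CochainComplex.isStrictlyGE_mappingCone (evalComplex f I.obj) n n (n - 1)⟩⟩

theorem evalComplex_naturality {I J : CochainComplex X.Modules ℤ} (b : I ⟶ J) :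
    evalComplex f I ≫ b =
      ((tensorStructureSheaf f).mapHomologicalComplex _).map
        (((globalSections f).mapHomologicalComplex _).map b) ≫ evalComplex f J := by
  ext n : 1
  exact ((tensorAdjunction f).counit.naturality (b.f n)).symm

variable [HasDerivedCategory.{w} X.Modules]

/-- `Hom^P(𝒪_X, K)`: the degree `P` cohomology of `hom^•(𝒪_X, I)`, where `I` is a
bounded below complex of injectives representing `K`. -/
def hyperext (K : DerivedCategory.Plus X.Modules) (P : ℤ) : ModuleCat.{0} ℂ :=
  (homComplex f (injectiveResolution K).obj).homology P

/-- The twist `T(K) = Cone(RHom(𝒪_X, K) ⊗_ℂ 𝒪_X ⟶ K)`. -/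
def twist (K : DerivedCategory.Plus X.Modules) : DerivedCategory.Plus X.Modules :=
  DerivedCategory.Plus.Q.obj (coneEvalComplex f (injectiveResolution K))

theorem nonempty_coneEvalComplex_iso {I J : CochainComplex.Plus X.Modules}
    (hI : CochainComplex.IsKInjective I.obj) (hJ : CochainComplex.IsKInjective J.obj)
    (e : DerivedCategory.Plus.Q.obj I ≅ DerivedCategory.Plus.Q.obj J) :
    Nonempty (DerivedCategory.Plus.Q.obj (coneEvalComplex f I) ≅
      DerivedCategory.Plus.Q.obj (coneEvalComplex f J)) := by
  obtain ⟨β, hβ⟩ := (DerivedCategory.Plus.Qh_map_bijective_of_isKInjective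
    ((HomotopyCategory.Plus.quotient _).obj I) ((HomotopyCategory.Plus.quotient _).obj J) hJ).2 e.hom
  obtain ⟨γ, hγ⟩ := (DerivedCategory.Plus.Qh_map_bijective_of_isKInjective
    ((HomotopyCategory.Plus.quotient _).obj J) ((HomotopyCategory.Plus.quotient _).obj I) hI).2 e.inv
  have h1 : β ≫ γ = 𝟙 _ := (DerivedCategory.Plus.Qh_map_bijective_of_isKInjective _ _ hI).1 (by
    rw [CategoryTheory.Functor.map_comp, hβ, hγ, CategoryTheory.Functor.map_id]; exact e.hom_inv_id)
  have h2 : γ ≫ β = 𝟙 _ := (DerivedCategory.Plus.Qh_map_bijective_of_isKInjective _ _ hJ).1 (by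
    rw [CategoryTheory.Functor.map_comp, hβ, hγ, CategoryTheory.Functor.map_id]; exact e.inv_hom_id)
  have hβi : IsIso β := ⟨γ, h1, h2⟩
  obtain ⟨b, rfl⟩ := (HomotopyCategory.Plus.quotient _).map_surjective β
  have hb : IsIso ((HomotopyCategory.quotient _ _).map b.hom) :=
    inferInstanceAs (IsIso ((HomotopyCategory.Plus.ι _).map
      ((HomotopyCategory.Plus.quotient _).map b)))
  have hb' := (HomologicalComplex.isIso_quotient_map_iff_homotopyEquivalences b.hom).1 hb
  obtain ⟨h, hh⟩ := hb'
  let a := ((tensorStructureSheaf f).mapHomologicalComplex (.up ℤ)).map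
        (((globalSections f).mapHomologicalComplex (.up ℤ)).map b.hom)
  have ha : IsIso ((HomotopyCategory.quotient _ _).map a) := by
    rw [HomologicalComplex.isIso_quotient_map_iff_homotopyEquivalences]
    refine ⟨(tensorStructureSheaf f).mapHomotopyEquiv ((globalSections f).mapHomotopyEquiv h), ?_⟩
    dsimp only [a]; rw [← hh]; rfl
  let τ := (HomotopyCategory.quotient X.Modules (.up ℤ)).mapTriangle.map
    (CochainComplex.mappingCone.triangleMap (evalComplex f I.obj) (evalComplex f J.obj) a b.hom
      (evalComplex_naturality f b.hom))
  have h3 : IsIso τ.hom₃ := Pretriangulated.isIso₃_of_isIso₁₂ τ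
    (HomotopyCategory.mappingCone_triangleh_distinguished _)
    (HomotopyCategory.mappingCone_triangleh_distinguished _) ha hb
  let e' : (HomotopyCategory.Plus.quotient _).obj (coneEvalComplex f I) ≅
      (HomotopyCategory.Plus.quotient _).obj (coneEvalComplex f J) :=
    (HomotopyCategory.Plus.ι _).preimageIso (@asIso _ _ _ _ τ.hom₃ h3)
  exact ⟨DerivedCategory.Plus.Qh.mapIso e'⟩

/-- Up to isomorphism, the twist does not depend on the choice of an injective resolution. -/
theorem nonempty_twist_iso {K : DerivedCategory.Plus X.Modules}
    (L : CochainComplex.Plus (InjectiveObject X.Modules))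
    (e : DerivedCategory.Plus.Q.obj
      ((InjectiveObject.ι X.Modules).mapCochainComplexPlus.obj L) ≅ K) :
    Nonempty (twist f K ≅ DerivedCategory.Plus.Q.obj
      (coneEvalComplex f ((InjectiveObject.ι X.Modules).mapCochainComplexPlus.obj L))) :=
  nonempty_coneEvalComplex_iso f
    (inferInstanceAs (CochainComplex.IsKInjective
      (((InjectiveObject.ι X.Modules).mapHomologicalComplex (.up ℤ)).obj
        (exists_injectiveResolution K).choose.obj)))
    (inferInstanceAs (CochainComplex.IsKInjective
      (((InjectiveObject.ι X.Modules).mapHomologicalComplex (.up ℤ)).obj L.obj)))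
    ((exists_injectiveResolution K).choose_spec.some ≪≫ e.symm)
end

section

variable {X : Scheme.{0}} [HasDerivedCategory.{w} X.Modules]

/-- The object of the derived category given by the sheaf `M` in degree `0`. -/
abbrev inDegreeZero (M : X.Modules) : DerivedCategory.Plus X.Modules :=
  (DerivedCategory.Plus.singleFunctor X.Modules 0).obj M

/-- The two-term complex `M ⟶ N` with `N` in degree `0`. -/
def twoTermComplex {M N : X.Modules} (φ : M ⟶ N) : DerivedCategory.Plus X.Modules :=
  DerivedCategory.Plus.Q.obj
    ⟨HomologicalComplex.double φ (show (ComplexShape.up ℤ).Rel (-1) 0 by simp), -1, by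
      rw [CochainComplex.isStrictlyGE_iff]
      intro i hi
      exact HomologicalComplex.isZero_double_X _ _ _ (by lia) (by lia)⟩

end

end CalabiYauTwist
end

/-!
Both twists are computed from the cohomology of `𝒪_X` and of `𝒪_p`.

*The derived category.* Let `K` be an object with `Hom(𝒪_X, K)` one-dimensional and concentrated in
degree `P`. Since complexes of vector spaces are formal, the evaluation map defining `T(K)` is
represented by a nonzero morphism `𝒪_X[-P] ⟶ K`, of which `T(K)` is the cone
(`exists_distTriang_twist`). For `K = 𝒪_p` the morphism is `𝒪_X ⟶ 𝒪_p`, up to a scalar, and its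
cone is `I_p[1]`. The long exact sequence of `0 ⟶ I_p ⟶ 𝒪_X ⟶ 𝒪_p ⟶ 0` leaves only
`H³(X, I_p) = ℂ`: the map `H⁰(X, 𝒪_X) ⟶ H⁰(X, 𝒪_p)` is a nonzero map between lines. So the same
construction applies to `K = I_p[1]`, with `P = 2`, and exhibits `T(T(𝒪_p))` as the cone of a
nonzero morphism `𝒪_X[-2] ⟶ I_p[1]`. That morphism spans `Hom²(𝒪_X, I_p[1])`, whose image in
`Hom²(𝒪_X, T(T(𝒪_p)))` is therefore zero. As `H¹(X, 𝒪_X) = 0`, the whole space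
`Hom²(𝒪_X, T(T(𝒪_p)))` vanishes, whereas `Hom²(𝒪_X, I_p[1] ⊕ 𝒪_X[-1])` contains `H³(X, I_p) ≠ 0`.

*Cohomology.* The remaining input is collected in `CohomologyData`. Injective modules are flasque
and flasque modules are acyclic, which settles the skyscraper `𝒪_p`. Vanishing above degree `3` is
Grothendieck's theorem. It is proved by showing that sections of the cocycles of degree `n` of an
injective resolution extend to all points of codimension at most `n` (`ExtendsTo.of_shortExact`), so
that the cocycles of degree `3` are flasque; points have codimension at most `3` because `X` is
locally quasi-finite over affine space. Global functions on a proper variety are constant, as they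
are integral over the algebraically closed field `ℂ`. Finally, duality identifies the dual of
`H³(X, ω)` with the endomorphisms of `ω`, which are scalars as `ω` is trivial.
-/

noncomputable section

/-! ### Sections of sheaves of modules -/

namespace CalabiYauTwist

/-- The underlying sheaf of abelian groups of an `𝒪_X`-module. -/
def toAbSheaf (X : Scheme.{0}) : X.Modules ⥤ TopCat.Sheaf AddCommGrpCat.{0} X :=
  SheafOfModules.toSheaf X.ringCatSheaf

variable {X : Scheme.{0}}

instance : (toAbSheaf X).Additive :=
  inferInstanceAs (SheafOfModules.toSheaf X.ringCatSheaf).Additive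
instance : (toAbSheaf X).Faithful :=
  inferInstanceAs (SheafOfModules.toSheaf X.ringCatSheaf).Faithful
instance : PreservesFiniteLimits (toAbSheaf X) :=
  inferInstanceAs (PreservesFiniteLimits (SheafOfModules.toSheaf X.ringCatSheaf))

lemma epi_map_of_map_cokernel_π_eq_zero {A B : Type*} [Category* A] [Category* B] [Abelian A]
    [Abelian B] (F : A ⥤ B) [F.Additive] [PreservesFiniteColimits F] {M N : A} (φ : M ⟶ N)
    (h : F.map (cokernel.π φ) = 0) : Epi (F.map φ) := by
  refine Preadditive.epi_of_cancel_zero _ fun {Z} g hg => ?_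
  obtain ⟨l, hl⟩ := CokernelCofork.IsColimit.desc'
    (CokernelCofork.mapIsColimit _ (cokernelIsCokernel φ) F) g hg
  let l' : F.obj (cokernel φ) ⟶ Z := l
  have hl' : F.map (cokernel.π φ) ≫ l' = g := hl
  rw [← hl', h, zero_comp]

/-- The cokernel of a morphism of sheaves of modules is the sheafification of the cokernel of
presheaves, and sheafification commutes with forgetting the module structure. -/
lemma toSheaf_map_epi {M N : SheafOfModules.{0} X.ringCatSheaf} (φ : M ⟶ N) (hφ : Epi φ) :
    Epi ((SheafOfModules.toSheaf X.ringCatSheaf).map φ) := by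
  let α := 𝟙 X.ringCatSheaf.obj
  let a := PresheafOfModules.sheafification α
  let adj := PresheafOfModules.sheafificationAdjunction α
  let φ' := (SheafOfModules.forget _ ⋙ PresheafOfModules.restrictScalars α).map φ
  let F := PresheafOfModules.toPresheaf X.ringCatSheaf.obj ⋙
    presheafToSheaf (Opens.grothendieckTopology X) AddCommGrpCat.{0}
  have h1 : Epi (a.map φ') := by
    have := adj.counit.naturality φ
    have h2 : a.map φ' = adj.counit.app M ≫ φ ≫ inv (adj.counit.app N) := by
      rw [← Category.assoc, IsIso.eq_comp_inv]; exact this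
    rw [h2]
    infer_instance
  have h2 : a.map (cokernel.π φ') = 0 := by
    rw [← cancel_epi (a.map φ'), ← Functor.map_comp, cokernel.condition, comp_zero]
    exact Functor.map_zero _ _ _
  have h3 : F.map (cokernel.π φ') = 0 := by
    change (SheafOfModules.toSheaf X.ringCatSheaf).map (a.map (cokernel.π φ')) = 0
    rw [h2]
    exact Functor.map_zero _ _ _
  have h4 : Epi (F.map φ') := epi_map_of_map_cokernel_π_eq_zero F φ' h3
  let ab := CategoryTheory.sheafificationAdjunction (Opens.grothendieckTopology X) AddCommGrpCat.{0}
  have h5 : F.map φ' ≫ ab.counit.app ((SheafOfModules.toSheaf X.ringCatSheaf).obj N) =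
      ab.counit.app ((SheafOfModules.toSheaf X.ringCatSheaf).obj M) ≫
        (SheafOfModules.toSheaf X.ringCatSheaf).map φ :=
    ab.counit.naturality ((SheafOfModules.toSheaf X.ringCatSheaf).map φ)
  have h6 : Epi (ab.counit.app ((SheafOfModules.toSheaf X.ringCatSheaf).obj M) ≫
        (SheafOfModules.toSheaf X.ringCatSheaf).map φ) := by
    rw [← h5]
    exact @epi_comp _ _ _ _ _ _ h4 _
      (@IsIso.epi_of_iso _ _ _ _ _ (isIso_sheafificationAdjunction_counit _))
  exact epi_of_epi (ab.counit.app ((SheafOfModules.toSheaf X.ringCatSheaf).obj M)) _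

instance (M N : X.Modules) (φ : M ⟶ N) [h : Epi φ] : Epi ((toAbSheaf X).map φ) :=
  toSheaf_map_epi (X := X) (M := M) (N := N) φ h

/-- The functor to sheaves of abelian groups is exact: it preserves finite limits, and cokernels
are computed by sheafifying presheaf cokernels. -/
lemma shortExact_map_toAbSheaf {S : ShortComplex X.Modules} (hS : S.ShortExact) :
    (S.map (toAbSheaf X)).ShortExact := by
  have := hS.mono_f
  have := hS.epi_g
  have : Mono (S.map (toAbSheaf X)).f := inferInstanceAs (Mono ((toAbSheaf X).map S.f))
  have : Epi (S.map (toAbSheaf X)).g := inferInstanceAs (Epi ((toAbSheaf X).map S.g))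
  exact ⟨hS.exact.map_of_mono_of_preservesKernel _ hS.mono_f inferInstance⟩

/-- Restriction of sections of a module. -/
abbrev res (M : X.Modules) {U V : X.Opens} (h : U ≤ V) : Γ(M, V) ⟶ Γ(M, U) :=
  M.presheaf.map (homOfLE h).op

lemma res_res (M : X.Modules) {U V W : X.Opens} (h : U ≤ V) (h' : V ≤ W) (s : Γ(M, W)) :
    res M h (res M h' s) = res M (h.trans h') s := by
  rw [← CategoryTheory.comp_apply, ← Functor.map_comp]
  rfl

lemma app_res {M N : X.Modules} (φ : M ⟶ N) {U V : X.Opens} (h : U ≤ V) (s : Γ(M, V)) :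
    φ.app U (res M h s) = res N h (φ.app V s) :=
  congr($(φ.mapPresheaf.naturality (homOfLE h).op) s)

/-- Epimorphisms of modules are locally surjective. -/
lemma exists_local_lift {M N : X.Modules} (φ : M ⟶ N) [Epi φ] {U : X.Opens} (s : Γ(N, U)) {x : X}
    (hx : x ∈ U) : ∃ (V : X.Opens) (h : V ≤ U) (t : Γ(M, V)), x ∈ V ∧ φ.app V t = res N h s := by
  have := (TopCat.Sheaf.isLocallySurjective_iff_epi ((toAbSheaf X).map φ)).mpr inferInstance
  obtain ⟨V, hV, ⟨t, ht⟩, hx⟩ := (TopCat.Presheaf.isLocallySurjective_iff _).mp this U s x hx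
  exact ⟨V, hV, t, hx, ht⟩

/-- Locally surjective morphisms of modules are epimorphisms. -/
lemma epi_of_exists_local_lift {M N : X.Modules} (φ : M ⟶ N)
    (h : ∀ (U : X.Opens) (s : Γ(N, U)) (x : X), x ∈ U →
      ∃ (V : X.Opens) (h : V ≤ U) (t : Γ(M, V)), x ∈ V ∧ φ.app V t = res N h s) : Epi φ := by
  have h' : TopCat.Presheaf.IsLocallySurjective ((toAbSheaf X).map φ).hom := by
    refine (TopCat.Presheaf.isLocallySurjective_iff _).mpr fun U s x hx => ?_
    obtain ⟨V, hV, t, hx, ht⟩ := h U s x hx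
    exact ⟨V, hV, ⟨t, ht⟩, hx⟩
  have := (TopCat.Sheaf.isLocallySurjective_iff_epi ((toAbSheaf X).map φ)).mp h'
  exact (toAbSheaf X).epi_of_epi_map this

/-- Sections of the kernel are the sections mapping to zero. -/
lemma exists_app_eq_of_shortExact {S : ShortComplex X.Modules} (hS : S.ShortExact) {U : X.Opens}
    (s : Γ(S.X₂, U)) (hs : S.g.app U s = 0) : ∃ t : Γ(S.X₁, U), S.f.app U t = s := by
  have h := shortExact_map_toAbSheaf hS
  exact TopCat.Sheaf.sections_exact_of_left_exact h.1 h.2 s hs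

lemma app_injective_of_mono {M N : X.Modules} (φ : M ⟶ N) [Mono φ] (U : X.Opens) :
    Function.Injective (φ.app U) := by
  have : Mono ((Scheme.Modules.toPresheaf X).map φ) := inferInstance
  have := (NatTrans.mono_iff_mono_app _).1 this (.op U)
  exact (AddCommGrpCat.mono_iff_injective _).1 this

lemma eq_of_res_eq (M : X.Modules) {U V W : X.Opens} (hU : U ≤ W) (hV : V ≤ W) (h : W ≤ U ⊔ V)
    {s t : Γ(M, W)} (h₁ : res M hU s = res M hU t) (h₂ : res M hV s = res M hV t) : s = t :=
  TopCat.Sheaf.eq_of_locally_eq₂ ((toAbSheaf X).obj M) (homOfLE hU) (homOfLE hV) h s t h₁ h₂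

/-- Gluing of two sections. -/
lemma exists_glue (M : X.Modules) {U V : X.Opens} (s : Γ(M, U)) (t : Γ(M, V))
    (h : res M inf_le_left s = res M (inf_le_right : U ⊓ V ≤ V) t) :
    ∃ r : Γ(M, U ⊔ V), res M le_sup_left r = s ∧ res M le_sup_right r = t := by
  let W : Bool → X.Opens := fun b => Bool.rec V U b
  let a : ∀ b, Γ(M, W b) := fun b => Bool.rec t s b
  have hW : ∀ b, W b ≤ U ⊔ V := Bool.forall_bool.2 ⟨le_sup_right, le_sup_left⟩
  obtain ⟨r, hr, _⟩ := TopCat.Sheaf.existsUnique_gluing' ((toAbSheaf X).obj M) W (U ⊔ V)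
    (fun b => homOfLE (hW b)) (sup_le (le_iSup W true) (le_iSup W false)) a (by
      rintro (_ | _) (_ | _)
      · rfl
      · have := congr(res M (inf_comm V U).le $h)
        rw [res_res, res_res] at this
        exact this.symm
      · exact h
      · rfl)
  exact ⟨r, hr true, hr false⟩

end CalabiYauTwist

/-! ### Flasque modules are acyclic -/

namespace CalabiYauTwist

section
variable {C : Type*} [Category.{0} C] {R : Cᵒᵖ ⥤ RingCat.{0}}

/-- A section over `V` is a morphism from the free presheaf of modules on `V`, and restriction to
`U` is the composition with the morphism of free presheaves given by `U ⟶ V`. -/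
lemma freeYonedaEquiv_map_comp {M : PresheafOfModules.{0} R} {U V : C} (i : U ⟶ V)
    (m : (PresheafOfModules.free R).obj (yoneda.obj V) ⟶ M) :
    PresheafOfModules.freeYonedaEquiv ((PresheafOfModules.free R).map (yoneda.map i) ≫ m) =
      M.map i.op (PresheafOfModules.freeYonedaEquiv m) := by
  have h := (PresheafOfModules.freeAdjunction R).homEquiv_naturality_left (yoneda.map i) m
  rw [PresheafOfModules.freeAdjunction_homEquiv, PresheafOfModules.freeAdjunction_homEquiv] at h
  exact (congrArg yonedaEquiv h).trans (yonedaEquiv_naturality _ i).symm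

lemma mono_free_map {F G : Cᵒᵖ ⥤ Type} (φ : F ⟶ G) (h : ∀ U, Function.Injective (φ.app U)) :
    Mono ((PresheafOfModules.free R).map φ) :=
  PresheafOfModules.mono_of_injective fun U => Finsupp.mapDomain_injective (h U)

end

variable {X : Scheme.{0}}

/-- Injective modules are flasque: a section over `U` is a morphism to `M` from the extension by
zero of `𝒪_U`, which is a submodule of the extension by zero of `𝒪_V`. -/
lemma res_surjective_of_injective (M : X.Modules) [hM : Injective M] {U V : X.Opens} (h : U ≤ V) :
    Function.Surjective (res M h) := by
  intro s
  let R := X.ringCatSheaf.obj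
  let adj := PresheafOfModules.sheafificationAdjunction (𝟙 R)
  let i := (PresheafOfModules.free R).map (yoneda.map (homOfLE h))
  have hi : Mono i := mono_free_map _ fun W a b _ =>
    show (show W.unop ⟶ U from a) = b from Subsingleton.elim _ _
  have hi' : Mono ((PresheafOfModules.sheafification (𝟙 R)).map i) := inferInstance
  let M' := (SheafOfModules.forget X.ringCatSheaf ⋙ PresheafOfModules.restrictScalars (𝟙 R)).obj M
  let s' : (PresheafOfModules.free R).obj (yoneda.obj U) ⟶ M' :=
    PresheafOfModules.freeYonedaEquiv.symm s
  obtain ⟨t', ht'⟩ := @Injective.factors X.Modules _ M hM _ _ ((adj.homEquiv _ M).symm s') _ hi'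
  let t : (PresheafOfModules.free R).obj (yoneda.obj V) ⟶ M' := adj.homEquiv _ M t'
  have ht : i ≫ t = s' := by
    have := adj.homEquiv_naturality_left i t'
    exact this.symm.trans ((congrArg (adj.homEquiv _ M) ht').trans (Equiv.apply_symm_apply _ _))
  refine ⟨PresheafOfModules.freeYonedaEquiv t, ?_⟩
  have h1 := freeYonedaEquiv_map_comp (homOfLE h) t
  refine (show _ = _ from h1.symm).trans ((congrArg _ ht).trans ?_)
  exact Equiv.apply_symm_apply _ _

/-- An `𝒪_X`-module is flasque if its sections over opens extend to larger opens. -/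
def IsFlasqueModule (M : X.Modules) : Prop :=
  ∀ (U V : X.Opens) (h : U ≤ V), Function.Surjective (res M h)

lemma IsFlasqueModule.toAbSheaf {M : X.Modules} (hM : IsFlasqueModule M) :
    TopCat.Sheaf.IsFlasque ((toAbSheaf X).obj M) where
  epi {_ _} i := (AddCommGrpCat.epi_iff_surjective _).2 (hM _ _ i.unop.le)

lemma IsFlasqueModule.app_surjective {S : ShortComplex X.Modules} (hS : S.ShortExact)
    (h : IsFlasqueModule S.X₁) (U : X.Opens) : Function.Surjective (S.g.app U) := by
  have : TopCat.Sheaf.IsFlasque (S.map (CalabiYauTwist.toAbSheaf X)).X₁ := h.toAbSheaf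
  exact (AddCommGrpCat.epi_iff_surjective _).1
    (TopCat.Sheaf.IsFlasque.epi_of_shortExact (U := U) (shortExact_map_toAbSheaf hS))

lemma IsFlasqueModule.of_shortExact {S : ShortComplex X.Modules} (hS : S.ShortExact)
    (h₁ : IsFlasqueModule S.X₁) (h₂ : IsFlasqueModule S.X₂) : IsFlasqueModule S.X₃ := by
  intro U V h s
  obtain ⟨t, rfl⟩ := h₁.app_surjective hS U s
  obtain ⟨r, rfl⟩ := h₂ U V h t
  exact ⟨S.g.app V r, (app_res _ _ _).symm⟩

section Cohomology
variable (f : X ⟶ Spec (CommRingCat.of ℂ)) {M : X.Modules} (I : InjectiveResolution M)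

/-- The short exact sequences of cycles of an injective resolution. -/
@[simps]
def cyclesSequence (n : ℕ) : ShortComplex X.Modules where
  f := I.cocomplex.iCycles n
  g := I.cocomplex.toCycles n (n + 1)
  zero := by
    rw [← cancel_mono (I.cocomplex.iCycles (n + 1)), Category.assoc,
      HomologicalComplex.toCycles_i, HomologicalComplex.iCycles_d, zero_comp]

lemma cyclesSequence_shortExact (n : ℕ) : (cyclesSequence I n).ShortExact := by
  have h1 : Mono (cyclesSequence I n).f := inferInstanceAs (Mono (I.cocomplex.iCycles n))
  have h2 : Epi (cyclesSequence I n).g :=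
    Preadditive.epi_of_isZero_cokernel' _ (I.cocomplex.homologyIsCokernel n (n + 1) (by simp))
      ((I.cocomplex.exactAt_iff_isZero_homology (n + 1)).1 (I.cocomplex_exactAt_succ n))
  refine ⟨ShortComplex.exact_of_f_is_kernel _ ?_⟩
  -- the cycles are the kernel of the differential, which factors through the cycles in degree `n+1`
  refine isKernelOfComp (I.cocomplex.iCycles (n + 1)) (I.cocomplex.d n (n + 1))
    (I.cocomplex.cyclesIsKernel n (n + 1) (by simp)) (cyclesSequence I n).zero ?_
  exact I.cocomplex.toCycles_i n (n + 1)

lemma nonempty_cycles_zero_iso : Nonempty (I.cocomplex.cycles 0 ≅ M) :=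
  ⟨IsLimit.conePointUniqueUpToIso (I.cocomplex.cyclesIsKernel 0 1 (by simp)) I.isLimitKernelFork⟩

lemma isFlasqueModule_cycles (n : ℕ) (h : IsFlasqueModule (I.cocomplex.cycles n)) (m : ℕ)
    (hm : n ≤ m) : IsFlasqueModule (I.cocomplex.cycles m) := by
  induction m, hm using Nat.le_induction with
  | base => exact h
  | succ m _ ih =>
    exact IsFlasqueModule.of_shortExact (cyclesSequence_shortExact I m) ih
      fun _ _ h => res_surjective_of_injective (I.cocomplex.X m) h

/-- Cohomology vanishes above a flasque module of cocycles of an injective resolution. -/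
lemma isZero_sheafCohomology_succ (n m : ℕ) (hm : n ≤ m)
    (h : IsFlasqueModule (I.cocomplex.cycles n)) :
    IsZero ((sheafCohomology f (m + 1)).obj M) := by
  refine IsZero.of_iso ?_ (I.isoRightDerivedObj (globalSections f) (m + 1))
  refine ((HomologicalComplex.exactAt_iff_isZero_homology _ _).1 ?_)
  rw [HomologicalComplex.exactAt_iff' _ m (m + 1) (m + 2) (by simp) (by simp),
    ShortComplex.moduleCat_exact_iff]
  intro x hx
  let x' : Γ(I.cocomplex.X (m + 1), ⊤) := x
  have hx' : (I.cocomplex.d (m + 1) (m + 2)).app ⊤ x' = 0 := hx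
  rw [← I.cocomplex.toCycles_i, Scheme.Modules.Hom.comp_app] at hx'
  obtain ⟨y, hy⟩ := exists_app_eq_of_shortExact (cyclesSequence_shortExact I (m + 1)) x'
    (app_injective_of_mono (I.cocomplex.iCycles (m + 2)) ⊤ (hx'.trans (map_zero _).symm))
  obtain ⟨z, rfl⟩ := (isFlasqueModule_cycles I n h m hm).app_surjective
    (cyclesSequence_shortExact I m) ⊤ y
  refine ⟨z, ?_⟩
  change (I.cocomplex.d m (m + 1)).app ⊤ z = x'
  rw [← I.cocomplex.toCycles_i]
  exact hy

end Cohomology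

lemma IsFlasqueModule.of_iso {M N : X.Modules} (e : M ≅ N) (h : IsFlasqueModule M) :
    IsFlasqueModule N := by
  intro U V hUV s
  obtain ⟨t, ht⟩ := h U V hUV (e.inv.app U s)
  refine ⟨e.hom.app V t, ?_⟩
  rw [← app_res, ht, ← CategoryTheory.comp_apply, ← Scheme.Modules.Hom.comp_app, e.inv_hom_id]
  rfl

/-- Flasque modules are acyclic. -/
lemma IsFlasqueModule.isZero_sheafCohomology {M : X.Modules} (h : IsFlasqueModule M)
    (f : X ⟶ Spec (CommRingCat.of ℂ)) (i : ℕ) (hi : i ≠ 0) :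
    IsZero ((sheafCohomology f i).obj M) := by
  obtain ⟨j, rfl⟩ := Nat.exists_eq_succ_of_ne_zero hi
  let I := CategoryTheory.injectiveResolution M
  exact isZero_sheafCohomology_succ f I 0 j (by lia)
    (h.of_iso (nonempty_cycles_zero_iso I).some.symm)

end CalabiYauTwist

/-! ### Vanishing of cohomology above the dimension -/

namespace CalabiYauTwist

/-- The points of a topological space of codimension at most `n`: every strict chain of
generizations of the point has length at most `n`. -/
def codimLE (X : Type*) [TopologicalSpace X] : ℕ → Set X
  | 0 => {x | ∀ y, y ⤳ x → y = x}
  | n + 1 => {x | ∀ y, y ⤳ x → y ≠ x → y ∈ codimLE X n}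

lemma codimLE_mono (X : Type*) [TopologicalSpace X] (n : ℕ) : codimLE X n ⊆ codimLE X (n + 1) := by
  induction n with
  | zero => exact fun x hx y hy hne => (hne (hx y hy)).elim
  | succ n ih => exact fun x hx y hy hne => ih (hx y hy hne)

/-- A set `Z = W ∖ W'` with `W, W'` open contains the generic points of the irreducible components
of its closure, so a point lies outside of this closure as soon as its generizations do. -/
lemma exists_isOpen_inter_subset {X : Type*} [TopologicalSpace X]
    [TopologicalSpace.NoetherianSpace X] [QuasiSober X] {W W' : Set X} (hW : IsOpen W)
    (hW' : IsOpen W') (x : X) (hx : ∀ y ∈ W, y ⤳ x → y ∈ W') :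
    ∃ N : Set X, IsOpen N ∧ x ∈ N ∧ N ∩ W ⊆ W' := by
  by_cases hxZ : x ∈ closure (W \ W')
  · exfalso
    obtain ⟨S, hS, hS', h⟩ :=
      TopologicalSpace.NoetherianSpace.exists_finite_set_isClosed_irreducible
      (isClosed_closure (s := W \ W'))
    have hZ : W \ W' ⊆ ⋃ T ∈ S, (W \ W') ∩ T := by
      intro z hz
      obtain ⟨T, hT, hzT⟩ := Set.mem_sUnion.1 (h.2 ▸ subset_closure hz)
      exact Set.mem_biUnion hT ⟨hz, hzT⟩
    have hxZ' := closure_mono hZ hxZ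
    rw [hS.closure_biUnion] at hxZ'
    obtain ⟨T, hT, hxT⟩ := Set.mem_iUnion₂.1 hxZ'
    have hTc : IsClosed T := hS' T hT
    have hTi : IsIrreducible T := h.1 T hT
    have hxT' : x ∈ T := hTc.closure_subset_iff.2 Set.inter_subset_right hxT
    obtain ⟨η, hη⟩ := QuasiSober.sober hTi hTc
    have hηx : η ⤳ x := hη.specializes hxT'
    obtain ⟨z, hz, hzT⟩ := closure_nonempty_iff.1 ⟨x, hxT⟩
    have hηW : η ∈ W := (hη.specializes hzT).mem_open hW hz.1
    have hηZ : η ∈ closure (W \ W') := h.2 ▸ Set.mem_sUnion_of_mem hη.mem hT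
    obtain ⟨y, hy, hy'⟩ := mem_closure_iff.1 hηZ W' hW' (hx η hηW hηx)
    exact hy'.2 hy
  · refine ⟨(closure (W \ W'))ᶜ, isClosed_closure.isOpen_compl, hxZ, fun y hy => ?_⟩
    by_contra hy'
    exact hy.1 (subset_closure ⟨hy.2, hy'⟩)

variable {X : Scheme.{0}}

lemma eq_of_le_bot (M : X.Modules) {U : X.Opens} (hU : U ≤ ⊥) (s t : Γ(M, U)) : s = t :=
  TopCat.Sheaf.eq_of_locally_eq' ((toAbSheaf X).obj M) (ι := PEmpty.{1}) (fun _ => ⊥) U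
    (fun i => i.elim) (hU.trans bot_le) s t (fun i => i.elim)

/-- Sections of `M` over opens extend to opens containing `T`. For `T = X` this says that `M` is
flasque. -/
def ExtendsTo (T : Set X) (M : X.Modules) : Prop :=
  ∀ (U : X.Opens) (s : Γ(M, U)), ∃ (V : X.Opens) (h : U ≤ V) (t : Γ(M, V)), T ⊆ V ∧ res M h t = s

lemma ExtendsTo.isFlasqueModule {M : X.Modules} (h : ExtendsTo Set.univ M) :
    IsFlasqueModule M := by
  intro U V hUV s
  obtain ⟨W, hW, t, hT, rfl⟩ := h U s
  exact ⟨res M (fun x _ => hT trivial) t, res_res ..⟩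

/-- The generic point of an irreducible space is its only point of codimension zero, and lies in
every nonempty open subset. -/
lemma extendsTo_codimLE_zero [IrreducibleSpace X] (M : X.Modules) :
    ExtendsTo (codimLE X 0) M := by
  intro U s
  by_cases hU : U = ⊥
  · exact ⟨⊤, le_top, 0, fun _ _ => trivial, eq_of_le_bot M hU.le _ _⟩
  · refine ⟨U, le_rfl, s, fun x hx => ?_, congr($(M.presheaf.map_id (.op U)) s)⟩
    rw [← hx _ (genericPoint_specializes x)]
    have hne : (U : Set X).Nonempty := by
      rw [Set.nonempty_iff_ne_empty]
      exact fun h => hU (TopologicalSpace.Opens.ext h)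
    exact ((genericPoint_spec X).mem_open_set_iff U.isOpen).2 (by simpa using hne)

/-- Over the opens `W'` containing `W ∩ T`, the obstruction to lifting is a section of the kernel
that can be removed by extending it to the points of `T`. -/
lemma ExtendsTo.exists_lift [TopologicalSpace.NoetherianSpace X] {S : ShortComplex X.Modules}
    (hS : S.ShortExact) {T : Set X} (h : ExtendsTo T S.X₁) {W : X.Opens} (t : Γ(S.X₃, W)) :
    ∃ (W' : X.Opens) (hW : W' ≤ W) (i : Γ(S.X₂, W')),
      T ∩ W ⊆ W' ∧ S.g.app W' i = res S.X₃ hW t := by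
  have := hS.epi_g
  have : WellFoundedGT X.Opens := ‹TopologicalSpace.NoetherianSpace X›
  obtain ⟨W', ⟨hW, i, hi⟩, hmax⟩ := (wellFounded_gt (α := X.Opens)).has_min
    {W' | ∃ (hW : W' ≤ W) (i : Γ(S.X₂, W')), S.g.app W' i = res S.X₃ hW t}
    ⟨⊥, bot_le, 0, eq_of_le_bot _ le_rfl _ _⟩
  refine ⟨W', hW, i, fun y hy => ?_, hi⟩
  obtain ⟨N, hNW, j, hyN, hj⟩ := exists_local_lift S.g t hy.2
  obtain ⟨k, hk⟩ := exists_app_eq_of_shortExact hS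
    (res S.X₂ (inf_le_right : W' ⊓ N ≤ N) j - res S.X₂ inf_le_left i) (by
      rw [map_sub, app_res, app_res, hi, hj, res_res, res_res, sub_self])
  obtain ⟨V, hV, k', hTV, hk'⟩ := h _ k
  -- `j` corrected by the extension of `k` agrees with `i` on `W' ∩ N`
  obtain ⟨r, hr, hr'⟩ := exists_glue S.X₂ i
    (res S.X₂ (inf_le_left : N ⊓ V ≤ N) j - res S.X₂ inf_le_right (S.f.app V k')) (by
      have hle : W' ⊓ (N ⊓ V) ≤ W' ⊓ N := inf_le_inf_left _ inf_le_left
      have h1 : res S.X₂ hle (res S.X₂ hV (S.f.app V k')) = _ :=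
        congrArg (res S.X₂ hle) ((app_res S.f hV k').symm.trans ((congrArg _ hk').trans hk))
      rw [res_res, map_sub, res_res, res_res] at h1
      rw [map_sub, res_res, res_res, h1, sub_sub_cancel])
  by_contra hy'
  refine hmax (W' ⊔ (N ⊓ V)) ⟨sup_le hW (inf_le_left.trans hNW), r, ?_⟩ ?_
  · refine eq_of_res_eq S.X₃ le_sup_left le_sup_right le_rfl ?_ ?_
    · rw [← app_res, hr, hi, res_res]
    · have h0 : S.g.app _ (S.f.app V k') = 0 := by
        rw [← CategoryTheory.comp_apply, ← Scheme.Modules.Hom.comp_app, S.zero]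
        rfl
      rw [← app_res, hr', map_sub, app_res, app_res, h0, hj, map_zero, sub_zero, res_res, res_res]
  · refine lt_of_le_of_ne le_sup_left fun h => hy' ?_
    rw [h]
    exact Or.inr ⟨hyN, hTV hy.1⟩

/-- The inductive step of Grothendieck's vanishing theorem: the cosyzygies of a module are flasque
in higher and higher codimension. -/
lemma ExtendsTo.of_shortExact [TopologicalSpace.NoetherianSpace X] {S : ShortComplex X.Modules}
    (hS : S.ShortExact) (n : ℕ) (h : ExtendsTo (codimLE X n) S.X₁) (h₂ : IsFlasqueModule S.X₂) :
    ExtendsTo (codimLE X (n + 1)) S.X₃ := by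
  intro U s
  have : WellFoundedGT X.Opens := ‹TopologicalSpace.NoetherianSpace X›
  obtain ⟨W, ⟨hW, t, rfl⟩, hmax⟩ := (wellFounded_gt (α := X.Opens)).has_min
    {W | ∃ (hW : U ≤ W) (t : Γ(S.X₃, W)), res S.X₃ hW t = s}
    ⟨U, le_rfl, s, congr($(S.X₃.presheaf.map_id (.op U)) s)⟩
  -- the section extends over a point, once it is defined at the proper generizations of the point
  have key (x : X) (hx : x ∈ codimLE X (n + 1)) (hx' : ∀ y, y ⤳ x → y ≠ x → y ∈ W) : x ∈ W := by
    by_contra hxW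
    obtain ⟨W', hW', i, hTW, hi⟩ := h.exists_lift hS t
    obtain ⟨j, rfl⟩ := h₂ W' ⊤ le_top i
    obtain ⟨N, hN, hxN, hNW⟩ := exists_isOpen_inter_subset W.isOpen W'.isOpen x
      fun y hy hyx => hTW ⟨hx y hyx (fun h => hxW (h ▸ hy)), hy⟩
    let N' : X.Opens := ⟨N, hN⟩
    have hNW' : W ⊓ N' ≤ W' := fun y hy => hNW ⟨hy.2, hy.1⟩
    obtain ⟨r, hr, -⟩ := exists_glue S.X₃ t (res S.X₃ (le_top : N' ≤ ⊤) (S.g.app ⊤ j)) (by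
      have := congr(res S.X₃ hNW' $hi)
      rw [res_res, app_res, res_res] at this
      rw [res_res, this])
    refine hmax (W ⊔ N') ⟨hW.trans le_sup_left, r, ?_⟩ ?_
    · rw [← hr, res_res]
    · refine lt_of_le_of_ne le_sup_left fun h => hxW ?_
      rw [h]
      exact Or.inr hxN
  have key' (m : ℕ) (hm : m ≤ n + 1) : codimLE X m ⊆ W := by
    induction m with
    | zero =>
      refine fun x hx => key x ?_ fun y hy hne => (hne (hx y hy)).elim
      exact monotone_nat_of_le_succ (codimLE_mono X) hm hx
    | succ m ih =>
      refine fun x hx => key x ?_ fun y hy hne => ih (by lia) (hx y hy hne)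
      exact monotone_nat_of_le_succ (codimLE_mono X) hm hx
  exact ⟨W, hW, t, key' _ le_rfl, rfl⟩

/-- Grothendieck vanishing: the cohomology of an irreducible noetherian scheme of dimension at most
`d` vanishes in degrees greater than `d`. -/
lemma isZero_sheafCohomology_of_codimLE [TopologicalSpace.NoetherianSpace X] [IrreducibleSpace X]
    (f : X ⟶ Spec (CommRingCat.of ℂ)) (M : X.Modules) (d : ℕ) (hd : codimLE X d = Set.univ) (i : ℕ)
    (hi : d < i) : IsZero ((sheafCohomology f i).obj M) := by
  obtain ⟨j, rfl⟩ := Nat.exists_eq_succ_of_ne_zero (by lia : i ≠ 0)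
  let I := CategoryTheory.injectiveResolution M
  have h (n : ℕ) : ExtendsTo (codimLE X n) (I.cocomplex.cycles n) := by
    induction n with
    | zero => exact extendsTo_codimLE_zero _
    | succ n ih =>
      exact ExtendsTo.of_shortExact (cyclesSequence_shortExact I n) n ih
        fun _ _ h => res_surjective_of_injective (I.cocomplex.X n) h
  exact isZero_sheafCohomology_succ f I d j (by lia) (hd ▸ h d).isFlasqueModule

end CalabiYauTwist

/-! ### The dimension of a smooth variety -/

namespace CalabiYauTwist

lemma mem_codimLE_of_isOpenEmbedding {X Z : Type*} [TopologicalSpace X] [TopologicalSpace Z]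
    {j : Z → X} (hj : Topology.IsOpenEmbedding j) (n : ℕ) (z : Z) (hz : z ∈ codimLE Z n) :
    j z ∈ codimLE X n := by
  induction n generalizing z with
  | zero =>
    intro y hy
    obtain ⟨y, rfl⟩ := hy.mem_open hj.isOpen_range ⟨z, rfl⟩
    rw [hz y (hj.isInducing.specializes_iff.1 hy)]
  | succ n ih =>
    intro y hy hne
    obtain ⟨y, rfl⟩ := hy.mem_open hj.isOpen_range ⟨z, rfl⟩
    exact ih y (hz y (hj.isInducing.specializes_iff.1 hy) fun h => hne (h ▸ rfl))

/-- A continuous map that does not identify a point with a proper generization of it maps strict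
chains of generizations to strict chains, so the codimension of the image bounds that of
the point. -/
lemma mem_codimLE_of_continuous {X Z : Type*} [TopologicalSpace X] [TopologicalSpace Z]
    {g : Z → X} (hg : Continuous g) (hg' : ∀ y z, y ⤳ z → g y = g z → y = z) (n : ℕ) (z : Z)
    (hz : g z ∈ codimLE X n) : z ∈ codimLE Z n := by
  induction n generalizing z with
  | zero => exact fun y hy => hg' y z hy (hz _ (hy.map hg))
  | succ n ih => exact fun y hy hne => ih y (hz _ (hy.map hg) fun h => hne (hg' y z hy h))

lemma mem_codimLE_of_height_le {R : Type*} [CommRing R] (n : ℕ) (p : PrimeSpectrum R)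
    (hp : Order.height p ≤ n) : p ∈ codimLE (PrimeSpectrum R) n := by
  have key (q : PrimeSpectrum R) (hq : q ⤳ p) (hne : q ≠ p) : Order.height q < Order.height p := by
    have hlt : q < p := lt_of_le_of_ne ((PrimeSpectrum.le_iff_specializes _ _).2 hq) hne
    exact Order.height_strictMono hlt
      (((Order.height_mono hlt.le).trans hp).trans_lt (ENat.natCast_lt_top n))
  induction n generalizing p with
  | zero =>
    intro q hq
    by_contra hne
    exact absurd ((key q hq hne).trans_le hp) (by simp)
  | succ n ih =>
    intro q hq hne
    have hq' : Order.height q ≤ n := by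
      have := (key q hq hne).trans_le hp
      rw [Nat.cast_add, Nat.cast_one] at this
      exact Order.le_of_lt_add_one this
    refine ih q hq' fun r hr hne => ?_
    have hlt : r < q := lt_of_le_of_ne ((PrimeSpectrum.le_iff_specializes _ _).2 hr) hne
    exact Order.height_strictMono hlt
      (((Order.height_mono hlt.le).trans hq').trans_lt (ENat.natCast_lt_top n))

lemma codimLE_primeSpectrum {R : Type*} [CommRing R] (n : ℕ) (h : ringKrullDim R ≤ n) :
    codimLE (PrimeSpectrum R) n = Set.univ := by
  refine Set.eq_univ_of_forall fun p => mem_codimLE_of_height_le n p ?_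
  exact_mod_cast (Order.height_le_krullDim p).trans h

/-- The dimension of a standard smooth algebra over a field is at most its relative dimension: the
algebra is quasi-finite over a polynomial ring. -/
lemma codimLE_of_isStandardSmooth {k R : Type} [CommRing k] [CommRing R] (hk : IsField k)
    (n : ℕ) {φ : k →+* R} (hφ : φ.IsStandardSmoothOfRelativeDimension n) :
    codimLE (PrimeSpectrum R) n = Set.univ := by
  obtain ⟨g, -, hg⟩ := hφ.exists_etale_mvPolynomial
  let := hk.toField
  have hdim : ringKrullDim (MvPolynomial (Fin n) k) ≤ n := by
    rw [MvPolynomial.ringKrullDim_of_isNoetherianRing, ringKrullDim_eq_zero_of_field, zero_add,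
      Nat.card_eq_fintype_card, Fintype.card_fin]
  refine Set.eq_univ_of_forall fun p => ?_
  algebraize [g]
  refine mem_codimLE_of_continuous (PrimeSpectrum.continuous_comap g) (fun P Q hPQ h => ?_) n p ?_
  · exact PrimeSpectrum.ext (Algebra.QuasiFinite.eq_of_le_of_under_eq
      (R := MvPolynomial (Fin n) k) P.asIdeal Q.asIdeal
      ((PrimeSpectrum.le_iff_specializes _ _).2 hPQ) congr(($h).asIdeal))
  · rw [codimLE_primeSpectrum n hdim]
    trivial

variable {X : Scheme.{0}} (f : X ⟶ Spec (CommRingCat.of ℂ))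

/-- A smooth scheme of relative dimension `n` over `ℂ` has dimension at most `n`. -/
lemma codimLE_of_smooth (n : ℕ) [SmoothOfRelativeDimension n f] : codimLE X n = Set.univ := by
  refine Set.eq_univ_of_forall fun x => ?_
  obtain ⟨U, hU, V, hV, hx, e, h⟩ :=
    SmoothOfRelativeDimension.exists_isStandardSmoothOfRelativeDimension (n := n) (f := f) x
  have hUtop : U = ⊤ := by
    refine top_le_iff.1 fun y _ => ?_
    have : y = f x := Subsingleton.elim (α := PrimeSpectrum ℂ) _ _
    rw [this]
    exact e hx
  subst hUtop
  have hk : IsField Γ(Spec (CommRingCat.of ℂ), ⊤) :=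
    MulEquiv.isField (Field.toIsField ℂ)
      (Scheme.ΓSpecIso (CommRingCat.of ℂ)).commRingCatIsoToRingEquiv.toMulEquiv
  obtain ⟨z, rfl⟩ : x ∈ Set.range hV.fromSpec := by
    rw [hV.range_fromSpec]
    exact hx
  refine mem_codimLE_of_isOpenEmbedding hV.fromSpec.isOpenEmbedding n z ?_
  exact (codimLE_of_isStandardSmooth hk n h).ge trivial

variable {f}

namespace IsCalabiYauThreefold

lemma isNoetherian (hX : IsCalabiYauThreefold f) : IsNoetherian X := by
  have := hX.isProper
  have : IsLocallyNoetherian X := LocallyOfFiniteType.isLocallyNoetherian f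
  have : CompactSpace X := QuasiCompact.compactSpace_of_compactSpace f
  exact {}

lemma isZero_sheafCohomology (hX : IsCalabiYauThreefold f) (M : X.Modules) (i : ℕ) (hi : 3 < i) :
    IsZero ((sheafCohomology f i).obj M) := by
  have := hX.isNoetherian
  have := hX.isIntegral
  have := hX.smooth
  exact isZero_sheafCohomology_of_codimLE f M 3 (codimLE_of_smooth f 3) i hi

end IsCalabiYauThreefold

end CalabiYauTwist

/-! ### The linear structure on the category of modules -/

namespace CalabiYauTwist

/-- A morphism of sheaves of modules from a morphism of presheaves of abelian groups. -/
def modulesHomMk {X : Scheme.{0}} {M N : X.Modules} (φ : M.presheaf ⟶ N.presheaf)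
    (hφ : ∀ (U : X.Opens) (r : Γ(X, U)) (x : Γ(M, U)),
      φ.app (.op U) (r • x) = r • (show Γ(N, U) from φ.app (.op U) x)) : M ⟶ N :=
  (⟨PresheafOfModules.homMk φ fun U r x => hφ U.unop r x⟩ : SheafOfModules.Hom M N)

/-- Multiplication by a global function, as an endomorphism of an `𝒪_X`-module. -/
def globalSmulApp {X : Scheme.{0}} (a : Γ(X, ⊤)) (M : X.Modules) : M ⟶ M :=
  modulesHomMk
    { app := fun U => M.smul (X.presheaf.map (homOfLE le_top).op a : Γ(X, U.unop))
      naturality := fun U V i => by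
        refine Eq.trans ?_ (M.map_comp_smul i.unop (X.presheaf.map (homOfLE le_top).op a)).symm
        refine congrArg (fun r => M.presheaf.map i ≫ M.smul (U := V.unop) r) ?_
        change _ = (X.presheaf.map _ ≫ X.presheaf.map _) a
        rw [← X.presheaf.map_comp]
        rfl }
    fun U r x => by
      change (X.presheaf.map (homOfLE le_top).op a : Γ(X, U)) • r • x = r • (_ : Γ(X, U)) • x
      rw [smul_smul, mul_comm, ← smul_smul]

lemma globalSmulApp_app {X : Scheme.{0}} (a : Γ(X, ⊤)) (M : X.Modules) (U : X.Opens) (x : Γ(M, U)) :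
    (globalSmulApp a M).app U x = (X.presheaf.map (homOfLE le_top).op a : Γ(X, U)) • x := rfl

/-- The action of global functions on `𝒪_X`-modules. -/
def globalSmul (X : Scheme.{0}) : Γ(X, ⊤) →+* CatCenter X.Modules where
  toFun a :=
    { app := fun M => globalSmulApp a M
      naturality := fun M N φ => by
        ext U x
        exact (φ.app_smul (X.presheaf.map (homOfLE le_top).op a : Γ(X, U)) x).symm }
  map_one' := by
    ext M U x
    change (X.presheaf.map (homOfLE le_top).op (1 : Γ(X, ⊤)) : Γ(X, U)) • x = x
    rw [map_one, one_smul]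
  map_mul' a b := by
    ext M U x
    change (X.presheaf.map (homOfLE le_top).op (a * b) : Γ(X, U)) • x =
      (X.presheaf.map (homOfLE le_top).op a : Γ(X, U)) •
          (X.presheaf.map (homOfLE le_top).op b : Γ(X, U)) • x
    rw [map_mul, mul_smul]
  map_zero' := by
    ext M U x
    change (X.presheaf.map (homOfLE le_top).op (0 : Γ(X, ⊤)) : Γ(X, U)) • x = 0
    rw [map_zero, zero_smul]
  map_add' a b := by
    ext M U x
    change (X.presheaf.map (homOfLE le_top).op (a + b) : Γ(X, U)) • x =
      (X.presheaf.map (homOfLE le_top).op a : Γ(X, U)) • x +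
        (X.presheaf.map (homOfLE le_top).op b : Γ(X, U)) • x
    rw [map_add, add_smul]

variable {X : Scheme.{0}} (f : X ⟶ Spec (CommRingCat.of ℂ))

/-- The structure morphism `ℂ ⟶ Γ(X, 𝒪_X)`. -/
def scalars : CommRingCat.of ℂ ⟶ Γ(X, ⊤) :=
  (Scheme.ΓSpecIso (CommRingCat.of ℂ)).inv ≫ f.appTop

/-- The category of modules on a scheme over `ℂ` is `ℂ`-linear. -/
abbrev linearModules : Linear ℂ X.Modules :=
  Linear.ofRingMorphism ((globalSmul X).comp (scalars f).hom)

lemma globalSections_smul (M : X.Modules) (c : ℂ) (x : Γ(M, ⊤)) :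
    c • (show (globalSections f).obj M from x) =
      (show (globalSections f).obj M from (show Γ(M, ⊤) from scalars f c • x)) := by
  refine congrArg (fun r : Γ(X, ⊤) => r • x) ?_
  change f.app ⊤ ((Spec (CommRingCat.of ℂ)).presheaf.map (𝟙 _)
    ((Scheme.ΓSpecIso (CommRingCat.of ℂ)).inv c)) = _
  rw [CategoryTheory.Functor.map_id]
  rfl

lemma globalSections_linear :
    let := linearModules f
    (globalSections f).Linear ℂ := by
  let := linearModules f
  refine ⟨fun {M N} φ c => ?_⟩
  ext x
  refine Eq.trans ?_ (globalSections_smul f N c (φ.app ⊤ x)).symm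
  refine (congrArg (φ.app ⊤) (globalSmulApp_app _ M ⊤ x)).trans ?_
  refine (φ.app_smul _ _).trans ?_
  refine congrArg (fun r : Γ(X, ⊤) => r • φ.app ⊤ x) ?_
  exact congrArg (fun g => g (scalars f c)) (X.presheaf.map_id _)

end CalabiYauTwist

/-! ### The structure sheaf and the skyscraper sheaf -/

namespace CalabiYauTwist

lemma final_opensMap {X Y : TopCat.{0}} (f : X ⟶ Y) :
    (TopologicalSpace.Opens.map f).Final :=
  Functor.final_of_exists_of_isFiltered _ (fun _ => ⟨⊤, ⟨homOfLE fun _ _ => trivial⟩⟩)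
    fun {_ c} _ _ => ⟨c, 𝟙 _, Subsingleton.elim _ _⟩

lemma nonempty_pullback_structureSheaf_iso {X Y : Scheme.{0}} (f : X ⟶ Y) :
    Nonempty ((Scheme.Modules.pullback f).obj (structureSheaf Y) ≅ structureSheaf X) := by
  have : (SheafOfModules.pushforward.{0} f.toRingCatSheafHom).IsRightAdjoint :=
    (Scheme.Modules.pullbackPushforwardAdjunction f).isRightAdjoint
  have h := @SheafOfModules.instIsIsoPullbackObjUnitToUnitOfFinal _ _ _ _ _ _ _ _ _ _
    f.toRingCatSheafHom this (final_opensMap f.base)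
  exact ⟨@asIso (SheafOfModules X.ringCatSheaf) _ _ _ _ h⟩

/-- The functor `- ⊗_ℂ 𝒪_X` is the pullback along `X ⟶ Spec ℂ`, and pullbacks preserve structure
sheaves. -/
lemma nonempty_tensorStructureSheaf_iso {X : Scheme.{0}} (f : X ⟶ Spec (CommRingCat.of ℂ)) :
    Nonempty ((tensorStructureSheaf f).obj (ModuleCat.of ℂ ℂ) ≅ structureSheaf X) :=
  nonempty_pullback_structureSheaf_iso f

lemma IsFlasqueModule.of_subsingleton {Y : Scheme.{0}} [Subsingleton Y] (M : Y.Modules) :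
    IsFlasqueModule M := by
  intro U V h s
  by_cases hU : U = ⊥
  · exact ⟨0, eq_of_le_bot M hU.le _ _⟩
  · have hU' : V ≤ U := by
      have : (U : Set Y).Nonempty := by
        rw [Set.nonempty_iff_ne_empty]
        exact fun h => hU (TopologicalSpace.Opens.ext h)
      obtain ⟨y, hy⟩ := this
      exact fun z _ => Subsingleton.elim y z ▸ hy
    exact ⟨res M hU' s, (res_res ..).trans congr($(M.presheaf.map_id (.op U)) s)⟩

lemma IsFlasqueModule.pushforward {Y Z : Scheme.{0}} (g : Y ⟶ Z) {M : Y.Modules}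
    (h : IsFlasqueModule M) : IsFlasqueModule ((Scheme.Modules.pushforward g).obj M) :=
  fun U V hUV => h (g ⁻¹ᵁ U) (g ⁻¹ᵁ V) (fun _ hx => hUV hx)

variable {X : Scheme.{0}} (p : X)

/-- The skyscraper sheaf is the direct image of a sheaf on the one-point space `Spec κ(p)`. -/
lemma isFlasqueModule_skyscraper : IsFlasqueModule (skyscraper p) :=
  (IsFlasqueModule.of_subsingleton _).pushforward _

/-- The morphism `Spec κ(p) ⟶ X` is a closed immersion, hence surjective on functions over affine
opens. -/
lemma epi_evalAtPoint (hp : IsClosed {p}) : Epi (evalAtPoint p) := by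
  have := isClosed_singleton_iff_isClosedImmersion.1 hp
  refine epi_of_exists_local_lift _ fun U s x hx => ?_
  obtain ⟨V, hV, hxV, hVU⟩ := X.isBasis_affineOpens.exists_subset_of_mem_open hx U.isOpen
  obtain ⟨V, hV, rfl⟩ := hV
  obtain ⟨t, ht⟩ := (X.fromSpecResidueField p).app_surjective V hV (res _ hVU s)
  exact ⟨V, hVU, t, hxV, ht⟩

lemma evalAtPoint_ne_zero : evalAtPoint p ≠ 0 := by
  intro h
  have h1 : (evalAtPoint p).app ⊤ (1 : Γ(X, ⊤)) = 0 := by rw [h]; rfl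
  have h2 : (1 : Γ(Spec (X.residueField p), ⊤)) = 0 :=
    ((X.fromSpecResidueField p).app ⊤).hom.map_one.symm.trans h1
  exact one_ne_zero h2

/-! ### Global functions on proper varieties -/

/-- The global functions on an integral proper scheme over `ℂ` are a domain that is integral over
the algebraically closed field `ℂ`. -/
lemma scalars_surjective {Y : Scheme.{0}} [IsIntegral Y] (g : Y ⟶ Spec (CommRingCat.of ℂ))
    [UniversallyClosed g] : Function.Surjective (scalars g) := by
  have : (scalars g).hom.IsIntegral := by
    refine RingHom.isIntegral_respectsIso.2 _
      (e := (Scheme.ΓSpecIso _).symm.commRingCatIsoToRingEquiv) ?_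
    exact isIntegral_appTop_of_universallyClosed g
  exact (IsAlgClosed.ringHom_bijective_of_isIntegral (scalars g).hom this).2

variable (f : X ⟶ Spec (CommRingCat.of ℂ))

lemma finrank_globalSections_structureSheaf [IsIntegral X] [UniversallyClosed f] :
    Module.finrank ℂ ((globalSections f).obj (structureSheaf X)) = 1 := by
  refine (finrank_eq_one_iff_of_nonzero' (show (globalSections f).obj (structureSheaf X) from
    (1 : Γ(X, ⊤))) (one_ne_zero (α := Γ(X, ⊤)))).2 fun w => ?_
  obtain ⟨c, hc⟩ := scalars_surjective f (show Γ(X, ⊤) from w)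
  refine ⟨c, (globalSections_smul f (structureSheaf X) c (1 : Γ(X, ⊤))).trans ?_⟩
  exact (mul_one (scalars f c : Γ(X, ⊤))).trans hc

lemma finrank_globalSections_skyscraper [UniversallyClosed f] (hp : IsClosed {p}) :
    Module.finrank ℂ ((globalSections f).obj (skyscraper p)) = 1 := by
  have := isClosed_singleton_iff_isClosedImmersion.1 hp
  refine (finrank_eq_one_iff_of_nonzero' (show (globalSections f).obj (skyscraper p) from
    (1 : Γ(Spec (X.residueField p), ⊤))) (one_ne_zero (α := Γ(Spec (X.residueField p), ⊤)))).2
    fun w => ?_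
  obtain ⟨c, hc⟩ := scalars_surjective (X.fromSpecResidueField p ≫ f)
    (show Γ(Spec (X.residueField p), ⊤) from w)
  refine ⟨c, (globalSections_smul f (skyscraper p) c (1 : Γ(Spec (X.residueField p), ⊤))).trans ?_⟩
  refine Eq.trans (mul_one ((X.fromSpecResidueField p).app ⊤ (scalars f c))) (Eq.trans ?_ hc)
  rfl

instance : PreservesFiniteLimits (globalSections f) := by
  have : (globalSections f).IsRightAdjoint := (tensorAdjunction f).isRightAdjoint
  infer_instance

lemma finrank_sheafCohomology_zero (M : X.Modules) :
    Module.finrank ℂ ((sheafCohomology f 0).obj M) =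
      Module.finrank ℂ ((globalSections f).obj M) :=
  ((globalSections f).rightDerivedZeroIsoSelf.app M).toLinearEquiv.finrank_eq

end CalabiYauTwist

/-! ### The top cohomology of a trivial dualizing sheaf -/

namespace CalabiYauTwist

lemma conj_smul_id {k : Type*} [CommRing k] {B : Type*} [Category* B] [Preadditive B] [Linear k B]
    {a b : B} (e : a ≅ b) (c : k) : e.hom ≫ (c • 𝟙 b) ≫ e.inv = c • 𝟙 a := by
  rw [Linear.smul_comp, Category.id_comp, Linear.comp_smul, Iso.hom_inv_id]

lemma rightDerived_map_smul_id {k : Type*} [CommRing k] {A : Type*} [Category* A] [Abelian A]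
    [Linear k A] [EnoughInjectives A] {B : Type*} [Category* B] [Abelian B] [Linear k B]
    (G : A ⥤ B) [G.Additive] [G.Linear k] (n : ℕ) (c : k) (M : A) :
    (G.rightDerived n).map (c • 𝟙 M) = c • 𝟙 ((G.rightDerived n).obj M) := by
  let P := CategoryTheory.injectiveResolution M
  have h := G.rightDerived_map_eq n (c • 𝟙 M) (P := P) (Q := P) (c • 𝟙 P.cocomplex) (by
    ext
    simp only [HomologicalComplex.comp_f, HomologicalComplex.smul_f_apply,
      CochainComplex.single₀_map_f_zero, Linear.comp_smul,
      Category.comp_id]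
    exact ((Linear.smul_comp _ _ _ c (𝟙 M) (P.ι.f 0)).trans
      (congrArg (c • ·) (Category.id_comp _))).symm)
  have h₁ : (G.mapHomologicalComplex (.up ℕ)).map (c • 𝟙 P.cocomplex) = c • 𝟙 _ := by
    rw [Functor.map_smul, CategoryTheory.Functor.map_id]
  have h₂ : (G.mapHomologicalComplex (.up ℕ) ⋙ HomologicalComplex.homologyFunctor _ _ n).map
      (c • 𝟙 P.cocomplex) = c • 𝟙 _ := by
    refine (congrArg (HomologicalComplex.homologyFunctor _ _ n).map h₁).trans ?_
    refine (ShortComplex.homologyMap_smul (𝟙 _) c).trans ?_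
    exact congrArg (c • ·) (ShortComplex.homologyMap_id _)
  exact h.trans ((congrArg (fun x => (P.isoRightDerivedObj G n).hom ≫ x ≫
    (P.isoRightDerivedObj G n).inv) h₂).trans (conj_smul_id (P.isoRightDerivedObj G n) c))

variable {X : Scheme.{0}} (f : X ⟶ Spec (CommRingCat.of ℂ))

/-- The endomorphisms of the structure sheaf of a proper variety are scalars. -/
lemma exists_smul_id_eq [IsIntegral X] [UniversallyClosed f]
    (φ : structureSheaf X ⟶ structureSheaf X) :
    let := linearModules f
    ∃ c : ℂ, φ = c • 𝟙 _ := by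
  intro
  obtain ⟨c, hc⟩ := scalars_surjective f (φ.app ⊤ (1 : Γ(X, ⊤)))
  refine ⟨c, Scheme.Modules.hom_ext _ _ fun U => ?_⟩
  ext x
  let x' : Γ(X, U) := x
  have h1 : φ.app U (1 : Γ(X, U)) =
      (X.presheaf.map (homOfLE le_top).op (scalars f c) : Γ(X, U)) := by
    rw [hc]
    refine Eq.trans ?_ (app_res φ (le_top : U ≤ ⊤) (1 : Γ(X, ⊤)))
    exact congrArg (φ.app U) (map_one (X.presheaf.map (homOfLE le_top).op).hom).symm
  have h2 : φ.app U (x' • (1 : Γ(X, U))) = x' • φ.app U (1 : Γ(X, U)) :=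
    φ.app_smul x' (1 : Γ(X, U))
  have h3 : x' • (1 : Γ(X, U)) = x' := mul_one x'
  rw [h3, h1] at h2
  refine h2.trans ?_
  exact mul_comm x' _

variable {f}

/-- If the dualizing sheaf `ω` is trivial, then its endomorphisms, which are dual to the top
cohomology of `ω`, are scalars. -/
lemma IsDualizingSheaf.finrank_eq_one [IsIntegral X] [UniversallyClosed f] {d : ℕ} {ω : X.Modules}
    {t : (sheafCohomology f d).obj ω ⟶ ModuleCat.of ℂ ℂ} (h : IsDualizingSheaf f d ω t)
    (e : ω ≅ structureSheaf X) :
    Module.finrank ℂ ((sheafCohomology f d).obj (structureSheaf X)) = 1 := by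
  let := linearModules f
  have := globalSections_linear f
  rw [← ((sheafCohomology f d).mapIso e).toLinearEquiv.finrank_eq, ← Subspace.dual_finrank_eq]
  obtain ⟨hinj, hsurj⟩ := h.bijective_pairing ω h.coherent
  refine (finrank_eq_one_iff_of_nonzero' (t.hom : Module.Dual ℂ ((sheafCohomology f d).obj ω)) ?_).2
    fun ψ => ?_
  · intro ht
    have ht' : t = 0 := ModuleCat.hom_ext ht
    have hid : 𝟙 ω = 0 := hinj (by simp only [ht', comp_zero])
    have h0 : 𝟙 (structureSheaf X) = 0 := by
      rw [← e.inv_hom_id, ← Category.id_comp e.hom, hid, zero_comp, comp_zero]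
    have h1 : (1 : Γ(X, ⊤)) = 0 :=
      congrArg (fun φ : structureSheaf X ⟶ structureSheaf X => φ.app ⊤ (1 : Γ(X, ⊤))) h0
    exact one_ne_zero h1
  · obtain ⟨φ, hφ⟩ := hsurj (ModuleCat.ofHom ψ)
    obtain ⟨c, hc⟩ := exists_smul_id_eq f (e.inv ≫ φ ≫ e.hom)
    have hφ' : φ = c • 𝟙 ω := by
      rw [← cancel_epi e.inv, ← cancel_mono e.hom, Category.assoc, hc, Linear.comp_smul,
        Linear.smul_comp, Category.comp_id, e.inv_hom_id]
    refine ⟨c, ?_⟩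
    have h2 : (c • 𝟙 ((sheafCohomology f d).obj ω)) ≫ t = ModuleCat.ofHom ψ := by
      rw [← rightDerived_map_smul_id, ← hφ']
      exact hφ
    rw [Linear.smul_comp, Category.id_comp] at h2
    exact congrArg ModuleCat.Hom.hom h2

end CalabiYauTwist

/-! ### Morphisms from a shifted object in the derived category -/

namespace CalabiYauTwist

section Abstract

universe w' v u

variable {k : Type v} [Field k] {A : Type u} [Category.{v} A] [Abelian A] [Linear k A]

section Cocycles

/-- The `k`-module of degree `n` cocycles of the complex `Hom(E, J)`. -/
def homCocycles (k : Type v) [Field k] [Linear k A] (E : A) (J : CochainComplex A ℤ) (n : ℤ) :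
    Submodule k (E ⟶ J.X n) :=
  LinearMap.ker (Linear.rightComp k E (J.d n (n + 1)))

variable (E : A) (J : CochainComplex A ℤ) (n : ℤ)

lemma mem_homCocycles_iff (φ : E ⟶ J.X n) :
    φ ∈ homCocycles k E J n ↔ φ ≫ J.d n (n + 1) = 0 := Iff.rfl

variable {E J n} in
/-- The morphism of complexes `E[-n] ⟶ J` given by a cocycle. -/
def ofHomCocycle (φ : homCocycles k E J n) :
    (HomologicalComplex.single A (.up ℤ) n).obj E ⟶ J :=
  HomologicalComplex.mkHomFromSingle φ.1 (by
    rintro m hm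
    obtain rfl : n + 1 = m := hm
    exact φ.2)

lemma ofHomCocycle_f (φ : homCocycles k E J n) :
    (ofHomCocycle φ).f n = (HomologicalComplex.singleObjXSelf (.up ℤ) n E).hom ≫ φ.1 :=
  HomologicalComplex.mkHomFromSingle_f _ _

lemma ofHomCocycle_surjective (α : (HomologicalComplex.single A (.up ℤ) n).obj E ⟶ J) :
    ∃ φ : homCocycles k E J n, ofHomCocycle φ = α := by
  refine ⟨⟨(HomologicalComplex.singleObjXSelf (.up ℤ) n E).inv ≫ α.f n, ?_⟩, ?_⟩
  · rw [mem_homCocycles_iff, Category.assoc, α.comm, HomologicalComplex.single_obj_d]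
    simp
  · apply HomologicalComplex.from_single_hom_ext
    rw [ofHomCocycle_f]
    simp

lemma ofHomCocycle_add (φ ψ : homCocycles k E J n) :
    ofHomCocycle (φ + ψ) = ofHomCocycle φ + ofHomCocycle ψ := by
  apply HomologicalComplex.from_single_hom_ext
  rw [HomologicalComplex.add_f_apply]
  simp only [ofHomCocycle_f]
  simp

lemma ofHomCocycle_smul (c : k) (φ : homCocycles k E J n) :
    ofHomCocycle (c • φ) = c • ofHomCocycle φ := by
  apply HomologicalComplex.from_single_hom_ext
  rw [HomologicalComplex.smul_f_apply]
  simp only [ofHomCocycle_f]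
  simp

/-- A cocycle gives a null-homotopic morphism if and only if it is a coboundary. -/
lemma nonempty_homotopy_ofHomCocycle_zero_iff (φ : homCocycles k E J n) (m : ℤ) (hm : m + 1 = n) :
    Nonempty (Homotopy (ofHomCocycle φ) 0) ↔ ∃ s : E ⟶ J.X m, s ≫ J.d m n = φ.1 := by
  constructor
  · rintro ⟨h⟩
    have h1 := h.comm n
    rw [ofHomCocycle_f, dNext_eq _ (show (ComplexShape.up ℤ).Rel n (n + 1) from rfl),
      prevD_eq _ (show (ComplexShape.up ℤ).Rel m n from hm),
      HomologicalComplex.single_obj_d] at h1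
    refine ⟨(HomologicalComplex.singleObjXSelf (.up ℤ) n E).inv ≫ h.hom n m, ?_⟩
    rw [← cancel_epi (HomologicalComplex.singleObjXSelf (.up ℤ) n E).hom, h1]
    simp
  · rintro ⟨s, hs⟩
    let S := (CochainComplex.singleFunctor A n).obj E
    let α : S ⟶ J := ofHomCocycle φ
    let z : CochainComplex.HomComplex.Cochain S J (-1) :=
      CochainComplex.HomComplex.Cochain.fromSingleMk s (p := n) (by lia)
    have key : CochainComplex.HomComplex.Cochain.ofHom α =
        CochainComplex.HomComplex.δ (-1) 0 z + CochainComplex.HomComplex.Cochain.ofHom 0 := by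
      rw [CochainComplex.HomComplex.Cochain.δ_fromSingleMk s _ 0 n (by lia), hs]
      simp only [CochainComplex.HomComplex.Cochain.ofHom_zero, add_zero]
      apply (CochainComplex.HomComplex.Cochain.fromSingleEquiv (X := E) (add_zero n)).injective
      refine Eq.trans ?_
        (CochainComplex.HomComplex.Cochain.fromSingleEquiv_fromSingleMk φ.1 (add_zero n)).symm
      change _ ≫ (CochainComplex.HomComplex.Cochain.ofHom α).v n n (add_zero n) = _
      rw [CochainComplex.HomComplex.Cochain.ofHom_v]
      exact (congrArg _ (ofHomCocycle_f E J n φ)).trans (Iso.inv_hom_id_assoc _ _)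
    exact ⟨(CochainComplex.HomComplex.Cochain.equivHomotopy α 0).symm ⟨z, key⟩⟩

end Cocycles

section Derived

variable [HasDerivedCategory.{w'} A] (E : A) (J : CochainComplex A ℤ) (n : ℤ)

/-- The linear map sending a cocycle of `Hom(E, J)` to the corresponding morphism
`E[-n] ⟶ J` in the derived category. -/
def homCocyclesToDerived :
    homCocycles k E J n →ₗ[k]
      ((DerivedCategory.singleFunctor A n).obj E ⟶ DerivedCategory.Q.obj J) where
  toFun φ := DerivedCategory.Q.map (ofHomCocycle φ)
  map_add' φ ψ := (congrArg _ (ofHomCocycle_add E J n φ ψ)).trans DerivedCategory.Q.map_add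
  map_smul' c φ := (congrArg _ (ofHomCocycle_smul E J n c φ)).trans
    (DerivedCategory.Q.map_smul c (ofHomCocycle φ))

lemma Q_map_surjective_of_isKInjective (K : CochainComplex A ℤ) [J.IsKInjective]
    (ψ : DerivedCategory.Q.obj K ⟶ DerivedCategory.Q.obj J) :
    ∃ α : K ⟶ J, DerivedCategory.Q.map α = ψ := by
  obtain ⟨β, hβ⟩ := (CochainComplex.IsKInjective.Qh_map_bijective
    ((HomotopyCategory.quotient _ _).obj K) J).2
    ((DerivedCategory.quotientCompQhIso A).hom.app K ≫ ψ ≫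
      (DerivedCategory.quotientCompQhIso A).inv.app J)
  obtain ⟨α, rfl⟩ := (HomotopyCategory.quotient _ _).map_surjective β
  refine ⟨α, ?_⟩
  have := DerivedCategory.quotientCompQhIso_hom_naturality α
  rw [hβ] at this
  rw [← cancel_epi ((DerivedCategory.quotientCompQhIso A).hom.app K), ← this]
  simp

lemma nonempty_homotopy_of_Q_map_eq_zero (K : CochainComplex A ℤ) [J.IsKInjective]
    (α : K ⟶ J) (h : DerivedCategory.Q.map α = 0) : Nonempty (Homotopy α 0) := by
  refine ⟨HomotopyCategory.homotopyOfEq _ _ ((CochainComplex.IsKInjective.Qh_map_bijective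
    ((HomotopyCategory.quotient _ _).obj K) J).1 ?_)⟩
  have := DerivedCategory.quotientCompQhIso_hom_naturality α
  rw [h, comp_zero] at this
  rw [← cancel_mono ((DerivedCategory.quotientCompQhIso A).hom.app J), this]
  simp

lemma homCocyclesToDerived_surjective [J.IsKInjective] :
    Function.Surjective (homCocyclesToDerived (k := k) E J n) := by
  intro ψ
  obtain ⟨α, hα⟩ := Q_map_surjective_of_isKInjective J _ ψ
  obtain ⟨φ, rfl⟩ := ofHomCocycle_surjective (k := k) E J n α
  exact ⟨φ, hα⟩

lemma homCocyclesToDerived_eq_zero_iff [J.IsKInjective] (φ : homCocycles k E J n) (m : ℤ)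
    (hm : m + 1 = n) :
    homCocyclesToDerived E J n φ = 0 ↔ ∃ s : E ⟶ J.X m, s ≫ J.d m n = φ.1 := by
  rw [← nonempty_homotopy_ofHomCocycle_zero_iff E J n φ m hm]
  constructor
  · exact nonempty_homotopy_of_Q_map_eq_zero J _ _
  · rintro ⟨h⟩
    exact (DerivedCategory.Q_map_eq_of_homotopy A h).trans (Functor.map_zero _ _ _)

/-- If the functor `G` to vector spaces is represented by `E`, then the cohomology of `G(J)`, for
a K-injective complex `J`, consists of the morphisms `E[-n] ⟶ J` in the derived category. -/
theorem nonempty_derivedHom_linearEquiv_homology [J.IsKInjective] {G : A ⥤ ModuleCat.{v} k}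
    [G.Additive]
    (e : ∀ M : A, (E ⟶ M) ≃ₗ[k] G.obj M)
    (he : ∀ (M N : A) (g : M ⟶ N) (φ : E ⟶ M), e N (φ ≫ g) = (G.map g).hom (e M φ)) :
    Nonempty (((DerivedCategory.singleFunctor A n).obj E ⟶ DerivedCategory.Q.obj J) ≃ₗ[k]
      (((G.mapHomologicalComplex _).obj J).homology n : ModuleCat k)) := by
  let S := ((G.mapHomologicalComplex _).obj J).sc' (n - 1) n (n + 1)
  let eH : ((G.mapHomologicalComplex _).obj J).homology n ≅ S.moduleCatLeftHomologyData.H :=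
    ((G.mapHomologicalComplex _).obj J).homologyIsoSc' (n - 1) n (n + 1) (by simp) (by simp) ≪≫
      S.moduleCatHomologyIso
  -- the cocycles of `Hom(E, J)` surject onto both sides, with the coboundaries as kernel
  let p : homCocycles k E J n →ₗ[k] LinearMap.ker S.g.hom :=
    LinearMap.restrict (e (J.X n)).toLinearMap (fun φ hφ => by
      change (G.map (J.d n (n + 1))).hom (e _ φ) = 0
      rw [← he, (mem_homCocycles_iff E J n φ).1 hφ, map_zero])
  have hp : Function.Surjective p := by
    rintro ⟨x, hx⟩
    obtain ⟨φ, rfl⟩ := (e (J.X n)).surjective x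
    refine ⟨⟨φ, ?_⟩, rfl⟩
    rw [mem_homCocycles_iff]
    apply (e (J.X (n + 1))).injective
    rw [he, map_zero]
    exact hx
  let q : homCocycles k E J n →ₗ[k]
      (LinearMap.ker S.g.hom ⧸ LinearMap.range S.moduleCatToCycles) :=
    (LinearMap.range S.moduleCatToCycles).mkQ ∘ₗ p
  have hq : Function.Surjective q := (Submodule.mkQ_surjective _).comp hp
  have hker : LinearMap.ker (homCocyclesToDerived E J n) = LinearMap.ker q := by
    ext φ
    rw [LinearMap.mem_ker, LinearMap.mem_ker,
      homCocyclesToDerived_eq_zero_iff E J n φ (n - 1) (by lia)]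
    change _ ↔ (LinearMap.range S.moduleCatToCycles).mkQ (p φ) = 0
    rw [Submodule.mkQ_apply, Submodule.Quotient.mk_eq_zero, LinearMap.mem_range]
    constructor
    · rintro ⟨s, hs⟩
      refine ⟨e _ s, Subtype.ext ?_⟩
      change (G.map (J.d (n - 1) n)).hom (e _ s) = e _ φ.1
      rw [← he, hs]
    · rintro ⟨y, hy⟩
      obtain ⟨s, rfl⟩ := (e (J.X (n - 1))).surjective y
      refine ⟨s, (e _).injective ?_⟩
      rw [he]
      exact congrArg Subtype.val hy
  exact ⟨(LinearMap.quotKerEquivOfSurjective _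
      (homCocyclesToDerived_surjective (k := k) E J n)).symm.trans
    ((Submodule.quotEquivOfEq _ _ hker).trans
      ((LinearMap.quotKerEquivOfSurjective q hq).trans eH.symm.toLinearEquiv))⟩

end Derived

end Abstract

end CalabiYauTwist

/-! ### Right derived functors of a representable functor -/

namespace CalabiYauTwist

section Abstract

universe w' v u v' u'

section Extend

lemma map_conj_comm {A : Type u} [Category.{v} A] {B : Type u'} [Category.{v'} B] (G : A ⥤ B)
    {a b a' b' : A} {c d : B}
    (x : a ≅ a') (y : b ≅ b') (δ : a' ⟶ b') (x' : c ≅ G.obj a')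
    (y' : d ≅ G.obj b') :
    (G.map x.hom ≫ x'.inv) ≫ x'.hom ≫ G.map δ ≫ y'.inv =
      G.map (x.hom ≫ δ ≫ y.inv) ≫ G.map y.hom ≫ y'.inv := by
  simp only [Category.assoc, Iso.inv_hom_id_assoc, Functor.map_comp]
  rw [← G.map_comp_assoc y.inv, Iso.inv_hom_id, G.map_id, Category.id_comp]

variable {A : Type u} [Category.{v} A] [Abelian A] {B : Type u'} [Category.{v'} B] [Abelian B]
  (G : A ⥤ B) [G.Additive] (K : CochainComplex A ℕ)

/-- The components of `mapExtendIso`. -/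
def mapExtendXIso : ∀ n : ℤ,
    ((G.mapHomologicalComplex _).obj (K.extend ComplexShape.embeddingUpNat)).X n ≅
      (((G.mapHomologicalComplex _).obj K).extend ComplexShape.embeddingUpNat).X n
  | .ofNat i => G.mapIso (K.extendXIso ComplexShape.embeddingUpNat (i := i) rfl) ≪≫
      (((G.mapHomologicalComplex _).obj K).extendXIso ComplexShape.embeddingUpNat (i := i) rfl).symm
  | .negSucc i => IsZero.iso
      (G.map_isZero (K.isZero_extend_X _ _ fun j hj => by simp at hj))
      (HomologicalComplex.isZero_extend_X _ _ _ fun j hj => by simp at hj)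

lemma mapExtendXIso_hom (n : ℤ) (i : ℕ) (h : ComplexShape.embeddingUpNat.f i = n) :
    (mapExtendXIso G K n).hom = G.map (K.extendXIso ComplexShape.embeddingUpNat h).hom ≫
      (((G.mapHomologicalComplex _).obj K).extendXIso ComplexShape.embeddingUpNat h).inv := by
  subst h
  rfl

/-- Additive functors commute with the extension by zero of complexes indexed by `ℕ`. -/
def mapExtendIso :
    (G.mapHomologicalComplex _).obj (K.extend ComplexShape.embeddingUpNat) ≅
      ((G.mapHomologicalComplex _).obj K).extend ComplexShape.embeddingUpNat :=
  HomologicalComplex.Hom.isoOfComponents (mapExtendXIso G K) (by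
    intro n m hnm
    by_cases hn : ∃ i, ComplexShape.embeddingUpNat.f i = n
    · obtain ⟨i, hi⟩ := hn
      have hj : ComplexShape.embeddingUpNat.f (i + 1) = m := by
        subst hi
        exact hnm
      rw [mapExtendXIso_hom G K n i hi, mapExtendXIso_hom G K m (i + 1) hj,
        Functor.mapHomologicalComplex_obj_d, K.extend_d_eq ComplexShape.embeddingUpNat hi hj,
        ((G.mapHomologicalComplex _).obj K).extend_d_eq ComplexShape.embeddingUpNat hi hj]
      exact map_conj_comm G _ _ _ _ _
    · exact (G.map_isZero (K.isZero_extend_X _ _ fun j hj => hn ⟨j, hj⟩)).eq_of_src _ _)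

end Extend

variable {k : Type v} [Field k] {A : Type u} [Category.{v} A] [Abelian A] [Linear k A]
  [HasDerivedCategory.{w'} A] {E : A} {G : A ⥤ ModuleCat.{v} k} [G.Additive]

instance isKInjective_cochainComplex {M : A} (P : InjectiveResolution M) :
    P.cochainComplex.IsKInjective :=
  CochainComplex.isKInjective_of_injective _ 0

/-- The derived functors of a functor `G` represented by `E` are the groups of morphisms from
`E[-n]` in the derived category. -/
theorem nonempty_derivedHom_linearEquiv_rightDerived [EnoughInjectives A]
    (e : ∀ M : A, (E ⟶ M) ≃ₗ[k] G.obj M)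
    (he : ∀ (M N : A) (g : M ⟶ N) (φ : E ⟶ M), e N (φ ≫ g) = (G.map g).hom (e M φ))
    (M : A) (n : ℕ) :
    Nonempty (((DerivedCategory.singleFunctor A n).obj E ⟶
      (DerivedCategory.singleFunctor A 0).obj M) ≃ₗ[k]
          ((G.rightDerived n).obj M : ModuleCat k)) := by
  let P := CategoryTheory.injectiveResolution M
  obtain ⟨e₁⟩ := nonempty_derivedHom_linearEquiv_homology E P.cochainComplex n e he
  have : IsIso (DerivedCategory.Q.map P.ι') :=
    (DerivedCategory.isIso_Q_map_iff_quasiIso (C := A) P.ι').mpr inferInstance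
  let e₂ : (DerivedCategory.singleFunctor A 0).obj M ≅ DerivedCategory.Q.obj P.cochainComplex :=
    @asIso _ _ _ _ (DerivedCategory.Q.map P.ι') this
  let e₃ : ((G.mapHomologicalComplex _).obj P.cochainComplex).homology n ≅
      (G.rightDerived n).obj M :=
    (HomologicalComplex.homologyFunctor _ _ _).mapIso (mapExtendIso G P.cocomplex) ≪≫
      HomologicalComplex.extendHomologyIso _ _ rfl ≪≫ (P.isoRightDerivedObj G n).symm
  exact ⟨((Linear.homCongr k (Iso.refl _) e₂).trans e₁).trans e₃.toLinearEquiv⟩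

variable (E) in
lemma derivedHom_single_eq_zero_of_neg (M : A) (n : ℤ) (hn : n < 0)
    (φ : (DerivedCategory.singleFunctor A n).obj E ⟶
      (DerivedCategory.singleFunctor A 0).obj M) : φ = 0 :=
  DerivedCategory.TStructure.t.zero φ n 0 hn

variable (k E) in
/-- The shift sends a morphism `E[-n-1] ⟶ K` to a morphism `E[-n] ⟶ K[1]`. -/
def derivedHomShift (K : DerivedCategory A) (n m : ℤ) (h : n + 1 = m) :
    ((DerivedCategory.singleFunctor A m).obj E ⟶ K) →ₗ[k]
      ((DerivedCategory.singleFunctor A n).obj E ⟶ K⟦(1 : ℤ)⟧) :=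
  Linear.leftComp k _ (((DerivedCategory.singleFunctors A).shiftIso 1 n m (by lia)).inv.app E) ∘ₗ
    (shiftFunctor (DerivedCategory A) (1 : ℤ)).mapLinearMap k

lemma derivedHomShift_apply (K : DerivedCategory A) (n m : ℤ) (h : n + 1 = m)
    (φ : (DerivedCategory.singleFunctor A m).obj E ⟶ K) :
    derivedHomShift k E K n m h φ =
      ((DerivedCategory.singleFunctors A).shiftIso 1 n m (by lia)).inv.app E ≫ φ⟦(1 : ℤ)⟧' := rfl

variable (k E) in
lemma derivedHomShift_bijective (K : DerivedCategory A) (n m : ℤ) (h : n + 1 = m) :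
    Function.Bijective (derivedHomShift k E K n m h) := by
  constructor
  · intro φ ψ hφψ
    rw [derivedHomShift_apply, derivedHomShift_apply, cancel_epi] at hφψ
    exact (shiftFunctor (DerivedCategory A) (1 : ℤ)).map_injective hφψ
  · intro ψ
    obtain ⟨φ, hφ⟩ := (shiftFunctor (DerivedCategory A) (1 : ℤ)).map_surjective
      (((DerivedCategory.singleFunctors A).shiftIso 1 n m (by lia)).hom.app E ≫ ψ)
    exact ⟨φ, by rw [derivedHomShift_apply, hφ, Iso.inv_hom_id_app_assoc]⟩

variable (k) in
lemma derivedHomShift_comp {K L : DerivedCategory A} (g : K ⟶ L) (n m : ℤ) (h : n + 1 = m)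
    (φ : (DerivedCategory.singleFunctor A m).obj E ⟶ K) :
    derivedHomShift k E L n m h (φ ≫ g) = derivedHomShift k E K n m h φ ≫ g⟦1⟧' := by
  rw [derivedHomShift_apply, derivedHomShift_apply, Functor.map_comp, Category.assoc]

end Abstract

end CalabiYauTwist

/-! ### Cones of evaluation maps -/

namespace CalabiYauTwist

section Abstract

universe w' v u

variable {k : Type v} [Field k]

/-- A complex of vector spaces whose cohomology is one-dimensional and concentrated in degree `P`
is quasi-isomorphic to `k[-P]`. -/
lemma exists_quasiIso_single (L : CochainComplex (ModuleCat.{v} k) ℤ) (P : ℤ)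
    (h₀ : ∀ n, n ≠ P → IsZero (L.homology n)) (h₁ : Module.finrank k (L.homology P) = 1) :
    ∃ α : (HomologicalComplex.single (ModuleCat.{v} k) (.up ℤ) P).obj (ModuleCat.of k k) ⟶ L,
      QuasiIso α := by
  obtain ⟨x, hx, hx'⟩ := finrank_eq_one_iff'.1 h₁
  obtain ⟨z, rfl⟩ := (ModuleCat.epi_iff_surjective (L.homologyπ P)).1 inferInstance x
  let ζ : ModuleCat.of k k ⟶ L.cycles P := ModuleCat.ofHom (LinearMap.toSpanSingleton k _ z)
  let α : (HomologicalComplex.single (ModuleCat.{v} k) (.up ℤ) P).obj (ModuleCat.of k k) ⟶ L :=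
    HomologicalComplex.mkHomFromSingle (ζ ≫ L.iCycles P) (by simp)
  have hζ : (HomologicalComplex.singleObjCyclesSelfIso (.up ℤ) P (ModuleCat.of k k)).inv ≫
      HomologicalComplex.cyclesMap α P = ζ := by
    rw [← cancel_mono (L.iCycles P), Category.assoc, HomologicalComplex.cyclesMap_i,
      HomologicalComplex.singleObjCyclesSelfIso_inv_iCycles_assoc,
      HomologicalComplex.mkHomFromSingle_f, Iso.inv_hom_id_assoc]
  have hH : (HomologicalComplex.singleObjHomologySelfIso (.up ℤ) P (ModuleCat.of k k)).inv ≫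
      HomologicalComplex.homologyMap α P = ζ ≫ L.homologyπ P := by
    rw [← hζ, Category.assoc, ← HomologicalComplex.homologyπ_naturality,
      HomologicalComplex.singleObjCyclesSelfIso_inv_homologyπ_assoc]
  have hiso : IsIso (ζ ≫ L.homologyπ P) := by
    rw [ConcreteCategory.isIso_iff_bijective]
    constructor
    · refine (injective_iff_map_eq_zero' (ζ ≫ L.homologyπ P).hom).2 fun c => ?_
      change (L.homologyπ P).hom (c • z) = 0 ↔ c = 0
      rw [map_smul, smul_eq_zero]
      exact or_iff_left hx
    · intro y
      obtain ⟨c, hc⟩ := hx' y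
      refine ⟨c, ?_⟩
      change (L.homologyπ P).hom (c • z) = y
      rw [map_smul]
      exact hc
  refine ⟨α, ⟨fun n => ?_⟩⟩
  rw [quasiIsoAt_iff_isIso_homologyMap]
  by_cases hn : n = P
  · subst hn
    rw [← hH] at hiso
    exact IsIso.of_isIso_comp_left
      (HomologicalComplex.singleObjHomologySelfIso (.up ℤ) n (ModuleCat.of k k)).inv _
  · exact (HomologicalComplex.isZero_single_obj_homology _ _ _ _ hn).isIso (h₀ n hn) _

variable {A : Type u} [Category.{v} A] [Abelian A]
  {T : ModuleCat.{v} k ⥤ A} {G : A ⥤ ModuleCat.{v} k}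

/-- Additive functors on vector spaces are exact, since all short exact sequences split. -/
lemma preservesHomology_of_additive (T : ModuleCat.{v} k ⥤ A) [T.Additive] :
    T.PreservesHomology := by
  refine (T.exact_tfae.out 0 2).1 fun S hS => ?_
  have : Projective S.X₃ :=
    (IsProjective.iff_projective S.X₃).1 inferInstance
  exact ((hS.splittingOfProjective).map T).shortExact

variable (adj : T ⊣ G)

section Repr

variable [T.Additive] [Linear k A] [G.Linear k]

/-- The object `T(k)` represents `G`. -/
def adjRepr (M : A) : (T.obj (ModuleCat.of k k) ⟶ M) ≃ₗ[k] G.obj M :=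
  LinearEquiv.trans (R₂ := k)
    { toFun := fun φ => adj.homEquiv _ _ φ
      invFun := fun φ => (adj.homEquiv _ _).symm φ
      left_inv := fun φ => Equiv.symm_apply_apply _ _
      right_inv := fun φ => Equiv.apply_symm_apply _ _
      map_add' := fun φ ψ => adj.homAddEquiv_add _ _ _ _
      map_smul' := fun c φ => by
        simp [Adjunction.homEquiv_unit] }
    (ModuleCat.homLinearEquiv.trans (LinearMap.ringLmapEquivSelf k k (G.obj M)))

lemma adjRepr_comp (M N : A) (g : M ⟶ N) (φ : T.obj (ModuleCat.of k k) ⟶ M) :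
    adjRepr adj N (φ ≫ g) = (G.map g).hom (adjRepr adj M φ) := by
  change (adj.homEquiv _ _ (φ ≫ g)).hom 1 = (G.map g).hom ((adj.homEquiv _ _ φ).hom 1)
  rw [adj.homEquiv_naturality_right]
  rfl

end Repr

variable [T.Additive] [G.Additive]

/-- The evaluation `T(G(J)) ⟶ J` for a complex `J`. -/
def adjEval (J : CochainComplex A ℤ) :
    (T.mapHomologicalComplex _).obj ((G.mapHomologicalComplex _).obj J) ⟶ J where
  f n := adj.counit.app (J.X n)
  comm' i j _ := (adj.counit.naturality (J.d i j)).symm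

/-- The unit `L ⟶ G(T(L))` for a complex of vector spaces `L`. -/
def adjCoeval (L : CochainComplex (ModuleCat.{v} k) ℤ) :
    L ⟶ (G.mapHomologicalComplex _).obj ((T.mapHomologicalComplex _).obj L) where
  f n := adj.unit.app (L.X n)
  comm' i j _ := (adj.unit.naturality (L.d i j)).symm

lemma adjCoeval_map_adjEval {L : CochainComplex (ModuleCat.{v} k) ℤ} {J : CochainComplex A ℤ}
    (α : L ⟶ (G.mapHomologicalComplex _).obj J) :
    adjCoeval adj L ≫ (G.mapHomologicalComplex _).map
      ((T.mapHomologicalComplex _).map α ≫ adjEval adj J) = α := by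
  ext n : 1
  exact (congrArg (adj.unit.app _ ≫ ·) (G.map_comp (T.map (α.f n)) _)).trans
    ((adj.unit_naturality_assoc (α.f n) (G.map (adj.counit.app (J.X n)))).trans
      ((congrArg (α.f n ≫ ·) (adj.right_triangle_components (J.X n))).trans (Category.comp_id _)))

variable [HasDerivedCategory.{w'} A]

set_option maxHeartbeats 400000 in
/-- If the cohomology of `G(J)` is one-dimensional and concentrated in degree `P`, then the cone of
the evaluation `T(G(J)) ⟶ J` is the cone of a nonzero morphism `T(k)[-P] ⟶ J`. -/
theorem exists_distTriang_mappingCone_adjEval (J : CochainComplex A ℤ) [J.IsKInjective] (P : ℤ)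
    (h₀ : ∀ n, n ≠ P → IsZero (((G.mapHomologicalComplex (.up ℤ)).obj J).homology n))
    (h₁ : Module.finrank k (((G.mapHomologicalComplex (.up ℤ)).obj J).homology P) = 1) :
    ∃ (φ : (DerivedCategory.singleFunctor A P).obj (T.obj (ModuleCat.of k k)) ⟶
        DerivedCategory.Q.obj J)
      (g : DerivedCategory.Q.obj J ⟶
        DerivedCategory.Q.obj (CochainComplex.mappingCone (adjEval adj J)))
      (h : DerivedCategory.Q.obj (CochainComplex.mappingCone (adjEval adj J)) ⟶
        ((DerivedCategory.singleFunctor A P).obj (T.obj (ModuleCat.of k k)))⟦(1 : ℤ)⟧),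
      φ ≠ 0 ∧ Pretriangulated.Triangle.mk φ g h ∈ distTriang _ := by
  obtain ⟨α, hα⟩ := exists_quasiIso_single _ P h₀ h₁
  have := preservesHomology_of_additive T
  have hTα : QuasiIso ((T.mapHomologicalComplex (.up ℤ)).map α) :=
    HomologicalComplex.quasiIso_map_of_preservesHomology _ _
  let s := (HomologicalComplex.singleMapHomologicalComplex T (.up ℤ) P).app (ModuleCat.of k k)
  let β := s.inv ≫ (T.mapHomologicalComplex (.up ℤ)).map α
  have hβ : IsIso (DerivedCategory.Q.map β) :=
    (DerivedCategory.isIso_Q_map_iff_quasiIso A β).2 inferInstance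
  let Δ := DerivedCategory.Q.mapTriangle.obj
    (CochainComplex.mappingCone.triangle (adjEval adj J))
  have hΔ : Δ ∈ distTriang _ := DerivedCategory.mappingCone_triangle_distinguished (adjEval adj J)
  let φ : (DerivedCategory.singleFunctor A P).obj (T.obj (ModuleCat.of k k)) ⟶
    DerivedCategory.Q.obj J := DerivedCategory.Q.map (β ≫ adjEval adj J)
  let b : (DerivedCategory.singleFunctor A P).obj (T.obj (ModuleCat.of k k)) ≅ Δ.obj₁ :=
    @asIso _ _ _ _ (DerivedCategory.Q.map β) hβ
  refine ⟨φ, Δ.mor₂, Δ.mor₃ ≫ b.inv⟦(1 : ℤ)⟧', ?_, ?_⟩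
  · intro hφ
    obtain ⟨H⟩ := nonempty_homotopy_of_Q_map_eq_zero J _ _ hφ
    have H₁ : Homotopy ((T.mapHomologicalComplex (.up ℤ)).map α ≫ adjEval adj J) 0 := by
      refine ((Homotopy.ofEq ?_).trans (H.compLeft s.hom)).trans (Homotopy.ofEq comp_zero)
      exact (congrArg (· ≫ adjEval adj J) (s.hom_inv_id_assoc _).symm).trans
        ((congrArg (· ≫ adjEval adj J) (Category.assoc _ _ _).symm).trans
          ((congrArg (· ≫ adjEval adj J) (Category.assoc s.hom s.inv _)).trans
            (Category.assoc s.hom β _)))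
    have H₂ : Homotopy α 0 :=
      ((Homotopy.ofEq (adjCoeval_map_adjEval adj α).symm).trans
        ((G.mapHomotopy H₁).compLeft (adjCoeval adj _))).trans (Homotopy.ofEq (by simp))
    have h₂ := H₂.homologyMap_eq P
    rw [HomologicalComplex.homologyMap_zero] at h₂
    have h₃ : IsIso (HomologicalComplex.homologyMap α P) := inferInstance
    rw [h₂] at h₃
    have h₄ : IsZero (((G.mapHomologicalComplex (.up ℤ)).obj J).homology P) :=
      (IsZero.iff_id_eq_zero _).2 (by
        rw [← cancel_epi (0 : ((HomologicalComplex.single (ModuleCat.{v} k) (.up ℤ) P).obj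
          (ModuleCat.of k k)).homology P ⟶ _)]
        simp)
    have := ModuleCat.subsingleton_of_isZero h₄
    rw [Module.finrank_zero_of_subsingleton] at h₁
    exact zero_ne_one h₁
  · refine Pretriangulated.isomorphic_distinguished _ hΔ _
      (Pretriangulated.Triangle.isoMk _ _ b (Iso.refl _) (Iso.refl _) ?_ ?_ ?_)
    · exact (Category.comp_id _).trans (DerivedCategory.Q.map_comp _ _)
    · exact (Category.comp_id _).trans (Category.id_comp _).symm
    · exact (Category.assoc _ _ _).trans ((congrArg (Δ.mor₃ ≫ ·)
        ((Functor.map_comp _ _ _).symm.trans ((congrArg _ b.inv_hom_id).trans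
          (CategoryTheory.Functor.map_id _ _)))).trans
      ((Category.comp_id _).trans (Category.id_comp _).symm))

end Abstract

end CalabiYauTwist

/-! ### Long exact sequences and cones -/

namespace CalabiYauTwist

open Pretriangulated

section Abstract

universe w' v u

variable {k : Type v} [Field k] {A : Type u} [Category.{v} A] [Abelian A] [Linear k A]
  [HasDerivedCategory.{w'} A] {E : A}

variable (k) in
include k in
/-- In the long exact sequence of a triangle, `Hom(E[-m], T.obj₁) ⟶ Hom(E[-m], T.obj₂)` is injective
if the preceding map `Hom(E[-n], T.obj₂) ⟶ Hom(E[-n], T.obj₃)`, where `n + 1 = m`, is surjective. -/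
lemma derivedHom_eq_zero_of_surjective (T : Triangle (DerivedCategory A)) (hT : T ∈ distTriang _)
    (n m : ℤ) (h : n + 1 = m)
    (hs : ∀ y : (DerivedCategory.singleFunctor A n).obj E ⟶ T.obj₃, ∃ x, x ≫ T.mor₂ = y)
    (φ : (DerivedCategory.singleFunctor A m).obj E ⟶ T.obj₁) (hφ : φ ≫ T.mor₁ = 0) : φ = 0 := by
  apply (derivedHomShift_bijective k E T.obj₁ n m h).1
  rw [map_zero]
  obtain ⟨y, hy⟩ := T.coyoneda_exact₁ hT (derivedHomShift k E T.obj₁ n m h φ) (by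
    rw [← derivedHomShift_comp, hφ, map_zero])
  obtain ⟨x, rfl⟩ := hs y
  rw [hy, Category.assoc, comp_distTriang_mor_zero₂₃ _ hT, comp_zero]

variable (k E) in
include k in
/-- The groups `Hom(E[-n], M)` and `Hom(E[-n-1], M[-1])` vanish simultaneously. -/
lemma derivedHom_single_eq_zero_of_succ (M : A) (n m i j : ℤ) (h : n + 1 = m) (h' : i + 1 = j)
    (h₀ : ∀ φ : (DerivedCategory.singleFunctor A n).obj E ⟶
      (DerivedCategory.singleFunctor A i).obj M, φ = 0)
    (φ : (DerivedCategory.singleFunctor A m).obj E ⟶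
      (DerivedCategory.singleFunctor A j).obj M) : φ = 0 := by
  apply (derivedHomShift_bijective k E _ n m h).1
  rw [map_zero, ← cancel_mono
    (((DerivedCategory.singleFunctors A).shiftIso 1 i j (by lia)).hom.app M), zero_comp]
  exact h₀ _

section Kernel

variable (k) {S : ShortComplex A} (hS : S.ShortExact)
  (h₃ : ∀ n : ℤ, n ≠ 0 → ∀ φ : (DerivedCategory.singleFunctor A n).obj E ⟶
    (DerivedCategory.singleFunctor A 0).obj S.X₃, φ = 0)
  (h₃' : Module.finrank k ((DerivedCategory.singleFunctor A 0).obj E ⟶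
    (DerivedCategory.singleFunctor A 0).obj S.X₃) = 1)
  (x : E ⟶ S.X₂) (hx : x ≫ S.g ≠ 0)

include hx in
lemma singleFunctor_map_comp_ne_zero : (DerivedCategory.singleFunctor A 0).map x ≫
    (DerivedCategory.singleFunctor A 0).map S.g ≠ 0 := by
  intro h
  rw [← Functor.map_comp] at h
  exact hx ((DerivedCategory.singleFunctor A 0).map_injective
    (h.trans (Functor.map_zero _ _ _).symm))

include hS h₃ h₃' hx

lemma derivedHom_kernel_injective (n : ℤ) (φ : (DerivedCategory.singleFunctor A n).obj E ⟶
    (DerivedCategory.singleFunctor A 0).obj S.X₁)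
    (hφ : φ ≫ (DerivedCategory.singleFunctor A 0).map S.f = 0) : φ = 0 := by
  obtain ⟨m, hm⟩ : ∃ m, m + 1 = n := ⟨n - 1, by lia⟩
  refine derivedHom_eq_zero_of_surjective k hS.singleTriangle hS.singleTriangle_distinguished
    m n hm (fun y => ?_) φ hφ
  by_cases hn : m = 0
  · subst hn
    obtain ⟨c, hc⟩ := (finrank_eq_one_iff_of_nonzero' _
      (singleFunctor_map_comp_ne_zero x hx)).1 h₃' y
    refine ⟨c • (DerivedCategory.singleFunctor A 0).map x, ?_⟩
    exact (Linear.smul_comp _ _ _ c ((DerivedCategory.singleFunctor A 0).map x)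
      ((DerivedCategory.singleFunctor A 0).map S.g)).trans hc
  · exact ⟨0, zero_comp.trans (h₃ _ hn y).symm⟩

/-- The long exact sequence of `0 ⟶ S.X₁ ⟶ S.X₂ ⟶ S.X₃ ⟶ 0`, when `Hom(E[-n], S.X₃)` is
one-dimensional and concentrated in degree `0`, where it comes from `S.X₂`. -/
lemma derivedHom_kernel_bijective (n : ℤ) (hn : n ≠ 0) : Function.Bijective
    (fun φ : (DerivedCategory.singleFunctor A n).obj E ⟶
      (DerivedCategory.singleFunctor A 0).obj S.X₁ =>
        φ ≫ (DerivedCategory.singleFunctor A 0).map S.f) := by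
  constructor
  · intro φ ψ h
    rw [← sub_eq_zero]
    refine derivedHom_kernel_injective k hS h₃ h₃' x hx n _ ?_
    rw [Preadditive.sub_comp]
    exact sub_eq_zero.2 h
  · intro ψ
    obtain ⟨φ, hφ⟩ := hS.singleTriangle.coyoneda_exact₂ hS.singleTriangle_distinguished ψ
      (h₃ n hn _)
    exact ⟨φ, hφ.symm⟩

/-- The map `Hom(E, S.X₂) ⟶ Hom(E, S.X₃)` is a nonzero map between lines, hence injective, so
`Hom(E, S.X₁)` vanishes. -/
lemma derivedHom_kernel_zero (h₂ : Module.finrank k ((DerivedCategory.singleFunctor A 0).obj E ⟶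
    (DerivedCategory.singleFunctor A 0).obj S.X₂) = 1)
    (φ : (DerivedCategory.singleFunctor A 0).obj E ⟶
    (DerivedCategory.singleFunctor A 0).obj S.X₁) : φ = 0 := by
  refine derivedHom_kernel_injective k hS h₃ h₃' x hx 0 _ ?_
  have hx' := singleFunctor_map_comp_ne_zero x hx
  obtain ⟨c, hc⟩ := (finrank_eq_one_iff_of_nonzero' ((DerivedCategory.singleFunctor A 0).map x)
    (fun h => hx' (by rw [h, zero_comp]))).1 h₂ (φ ≫ (DerivedCategory.singleFunctor A 0).map S.f)
  have h₀ : (DerivedCategory.singleFunctor A 0).map S.f ≫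
      (DerivedCategory.singleFunctor A 0).map S.g = 0 := by
    rw [← Functor.map_comp, S.zero, Functor.map_zero]
  have hc₀ : c = 0 := by
    have := congrArg (· ≫ (DerivedCategory.singleFunctor A 0).map S.g) hc
    rw [Linear.smul_comp, Category.assoc, h₀, comp_zero, smul_eq_zero] at this
    exact this.resolve_right hx'
  rw [← hc, hc₀, zero_smul]

omit h₃ in
/-- If `Hom(E, S.X₃)` is one-dimensional and `E ≅ S.X₂`, then the cone of a nonzero
morphism `E ⟶ S.X₃` is `S.X₁[1]`. -/
lemma nonempty_cone_iso_shift_kernel [IsIso x] (T : Triangle (DerivedCategory A))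
    (hT : T ∈ distTriang _) (e₁ : T.obj₁ ≅ (DerivedCategory.singleFunctor A 0).obj E)
    (e₂ : T.obj₂ ≅ (DerivedCategory.singleFunctor A 0).obj S.X₃) (hT₁ : T.mor₁ ≠ 0) :
    Nonempty (T.obj₃ ≅ ((DerivedCategory.singleFunctor A 0).obj S.X₁)⟦(1 : ℤ)⟧) := by
  obtain ⟨c, hc⟩ := (finrank_eq_one_iff_of_nonzero' _ (singleFunctor_map_comp_ne_zero x hx)).1 h₃'
    (e₁.inv ≫ T.mor₁ ≫ e₂.hom)
  have hc₀ : c ≠ 0 := by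
    rintro rfl
    rw [zero_smul] at hc
    apply hT₁
    rw [← cancel_epi e₁.inv, ← cancel_mono e₂.hom, Category.assoc, ← hc]
    simp
  let a : T.obj₁ ≅ (DerivedCategory.singleFunctor A 0).obj S.X₂ :=
    e₁ ≪≫ (DerivedCategory.singleFunctor A 0).mapIso
      { hom := c • x
        inv := c⁻¹ • inv x
        hom_inv_id := by simp [smul_smul, hc₀]
        inv_hom_id := by simp [smul_smul, hc₀] }
  exact ⟨Triangle.π₃.mapIso (isoTriangleOfIso₁₂ T _ hT
    (rot_of_distTriang _ hS.singleTriangle_distinguished) a e₂ (by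
      change T.mor₁ ≫ e₂.hom = (e₁.hom ≫ (DerivedCategory.singleFunctor A 0).map (c • x)) ≫
        (DerivedCategory.singleFunctor A 0).map S.g
      rw [Functor.map_smul, Category.assoc, Linear.smul_comp, hc, Iso.hom_inv_id_assoc]))⟩

end Kernel

section Cone

variable {I : A} (T : Triangle (DerivedCategory A)) (hT : T ∈ distTriang _)

include hT

/-- The cone of a nonzero morphism from `E[-P]` to an object `K` with `Hom(E[-P], K)`
one-dimensional receives no nonzero morphism from `E[-P]`, if `Hom(E, E[1]) = 0`. -/
lemma derivedHom_cone_eq_zero (P : ℤ) (h₁ : T.obj₁ = (DerivedCategory.singleFunctor A P).obj E)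
    (h₀ : ∀ φ : (DerivedCategory.singleFunctor A P).obj E ⟶
      ((DerivedCategory.singleFunctor A P).obj E)⟦(1 : ℤ)⟧, φ = 0)
    (h₂ : Module.finrank k ((DerivedCategory.singleFunctor A P).obj E ⟶ T.obj₂) = 1)
    (hT₁ : T.mor₁ ≠ 0) (φ : (DerivedCategory.singleFunctor A P).obj E ⟶ T.obj₃) : φ = 0 := by
  obtain ⟨X, Y, Z, f, g, h⟩ := T
  obtain rfl := h₁
  obtain ⟨x, rfl⟩ := Triangle.coyoneda_exact₃ _ hT φ (h₀ _)
  obtain ⟨c, rfl⟩ := (finrank_eq_one_iff_of_nonzero' f hT₁).1 h₂ x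
  rw [Linear.smul_comp]
  exact (congrArg (c • ·) (comp_distTriang_mor_zero₁₂ _ hT)).trans (smul_zero c)

omit hT in
lemma isZero_homology_of_iso_single {K : DerivedCategory A} {M : A} (m : ℤ)
    (e : K ≅ (DerivedCategory.singleFunctor A m).obj M) (n : ℤ) (hn : n ≠ m) :
    IsZero ((DerivedCategory.homologyFunctor A n).obj K) := by
  refine IsZero.of_iso ?_ ((DerivedCategory.homologyFunctor A n).mapIso e)
  rcases hn.lt_or_gt with h | h
  · exact DerivedCategory.isZero_of_isGE _ m n h
  · exact DerivedCategory.isZero_of_isLE _ m n h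

variable {M : A} (e₁ : T.obj₁ ≅ (DerivedCategory.singleFunctor A 2).obj M)
  (e₂ : T.obj₂ ≅ (DerivedCategory.singleFunctor A (-1)).obj I)

include e₁ e₂

/-- In the long exact cohomology sequence of the cone of a morphism `M[-2] ⟶ I[1]`, the cohomology
of the source and of the target is concentrated in degrees `2` and `-1`, so that no cancellation
takes place. -/
lemma nonempty_homology_cone_iso_neg_one :
    Nonempty ((DerivedCategory.homologyFunctor A (-1)).obj T.obj₃ ≅ I) := by
  have h₁ : Mono ((DerivedCategory.homologyFunctor A (-1)).map T.mor₂) :=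
    (DerivedCategory.HomologySequence.mono_homologyMap_mor₂_iff T hT (-1)).2
      ((isZero_homology_of_iso_single 2 e₁ (-1) (by lia)).eq_of_src _ _)
  have h₂ : Epi ((DerivedCategory.homologyFunctor A (-1)).map T.mor₂) :=
    (DerivedCategory.HomologySequence.epi_homologyMap_mor₂_iff T hT (-1) 0 (by lia)).2
      ((isZero_homology_of_iso_single 2 e₁ 0 (by lia)).eq_of_tgt _ _)
  have := isIso_of_mono_of_epi ((DerivedCategory.homologyFunctor A (-1)).map T.mor₂)
  exact ⟨(asIso ((DerivedCategory.homologyFunctor A (-1)).map T.mor₂)).symm ≪≫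
    (DerivedCategory.homologyFunctor A (-1)).mapIso e₂ ≪≫
    (DerivedCategory.singleFunctorCompHomologyFunctorIso A (-1)).app I⟩

lemma nonempty_homology_cone_iso_one :
    Nonempty ((DerivedCategory.homologyFunctor A 1).obj T.obj₃ ≅ M) := by
  have h₁ : Mono (DerivedCategory.HomologySequence.δ T 1 2 rfl) :=
    (DerivedCategory.HomologySequence.exact₃ T hT 1 2 rfl).mono_g
      ((isZero_homology_of_iso_single (-1) e₂ 1 (by lia)).eq_of_src _ _)
  have h₂ : Epi (DerivedCategory.HomologySequence.δ T 1 2 rfl) :=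
    (DerivedCategory.HomologySequence.exact₁ T hT 1 2 rfl).epi_f
      ((isZero_homology_of_iso_single (-1) e₂ 2 (by lia)).eq_of_tgt _ _)
  have := isIso_of_mono_of_epi (DerivedCategory.HomologySequence.δ T 1 2 rfl)
  exact ⟨asIso (DerivedCategory.HomologySequence.δ T 1 2 rfl) ≪≫
    (DerivedCategory.homologyFunctor A 2).mapIso e₁ ≪≫
    (DerivedCategory.singleFunctorCompHomologyFunctorIso A 2).app M⟩

lemma isZero_homology_cone (n : ℤ) (hn : n ≠ -1) (hn' : n ≠ 1) :
    IsZero ((DerivedCategory.homologyFunctor A n).obj T.obj₃) :=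
  (DerivedCategory.HomologySequence.exact₃ T hT n (n + 1) rfl).isZero_of_both_zeros
    ((isZero_homology_of_iso_single (-1) e₂ n hn).eq_of_src _ _)
    ((isZero_homology_of_iso_single 2 e₁ (n + 1) (by lia)).eq_of_tgt _ _)

end Cone

end Abstract

end CalabiYauTwist

/-! ### The twist and its cohomology -/

namespace CalabiYauTwist

open Pretriangulated

section

variable {C : Type*} [Category* C] [Abelian C] [HasDerivedCategory.{w} C]

/-- Up to isomorphism, a distinguished triangle in the derived category whose objects are bounded
below comes from the bounded below derived category. -/
lemma exists_distTriang_plus {K₁ K₂ K₃ : DerivedCategory.Plus C} {T : Triangle (DerivedCategory C)}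
    (hT : T ∈ distTriang _) (e₁ : DerivedCategory.Plus.ι.obj K₁ ≅ T.obj₁)
    (e₂ : DerivedCategory.Plus.ι.obj K₂ ≅ T.obj₂) (e₃ : DerivedCategory.Plus.ι.obj K₃ ≅ T.obj₃)
    (h : T.mor₁ ≠ 0) :
    ∃ (φ : K₁ ⟶ K₂) (g : K₂ ⟶ K₃) (δ : K₃ ⟶ K₁⟦(1 : ℤ)⟧),
      φ ≠ 0 ∧ Triangle.mk φ g δ ∈ distTriang _ := by
  let s : DerivedCategory.Plus.ι.obj (K₁⟦(1 : ℤ)⟧) ≅ (DerivedCategory.Plus.ι.obj K₁)⟦(1 : ℤ)⟧ :=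
    (DerivedCategory.Plus.ι (C := C)).commShiftIso (1 : ℤ) |>.app K₁
  refine ⟨DerivedCategory.Plus.ι.preimage (e₁.hom ≫ T.mor₁ ≫ e₂.inv),
    DerivedCategory.Plus.ι.preimage (e₂.hom ≫ T.mor₂ ≫ e₃.inv),
    DerivedCategory.Plus.ι.preimage (e₃.hom ≫ T.mor₃ ≫ e₁.inv⟦1⟧' ≫ s.inv), ?_, ?_⟩
  · intro h'
    have h₁ := DerivedCategory.Plus.ι.map_preimage (e₁.hom ≫ T.mor₁ ≫ e₂.inv)
    rw [h', Functor.map_zero] at h₁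
    apply h
    rw [← cancel_epi e₁.hom, ← cancel_mono e₂.inv, Category.assoc, ← h₁]
    simp
  · rw [← (DerivedCategory.Plus.ι (C := C)).map_distinguished_iff]
    refine isomorphic_distinguished _ hT _ (Triangle.isoMk _ _ e₁ e₂ e₃ ?_ ?_ ?_)
    · refine (congrArg (· ≫ e₂.hom) (DerivedCategory.Plus.ι.map_preimage _)).trans ?_
      change (e₁.hom ≫ T.mor₁ ≫ e₂.inv) ≫ e₂.hom = e₁.hom ≫ T.mor₁
      simp
    · refine (congrArg (· ≫ e₃.hom) (DerivedCategory.Plus.ι.map_preimage _)).trans ?_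
      change (e₂.hom ≫ T.mor₂ ≫ e₃.inv) ≫ e₃.hom = e₂.hom ≫ T.mor₂
      simp
    · refine (congrArg (fun x => (x ≫ s.hom) ≫ e₁.hom⟦1⟧')
        (DerivedCategory.Plus.ι.map_preimage _)).trans ?_
      change ((e₃.hom ≫ T.mor₃ ≫ e₁.inv⟦(1 : ℤ)⟧' ≫ s.inv) ≫ s.hom) ≫ e₁.hom⟦(1 : ℤ)⟧' =
        e₃.hom ≫ T.mor₃
      simp only [Category.assoc, Iso.inv_hom_id_assoc]
      rw [← Functor.map_comp, Iso.inv_hom_id, CategoryTheory.Functor.map_id, Category.comp_id]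

end

section

variable {X : Scheme.{0}} (f : X ⟶ Spec (CommRingCat.of ℂ))

/-- The sheaf `ℂ ⊗_ℂ 𝒪_X`. -/
abbrev scalarSheaf : X.Modules := (tensorStructureSheaf f).obj (ModuleCat.of ℂ ℂ)

variable [HasDerivedCategory.{w} X.Modules]

/-- The injective resolution of `K` represents `K` in the derived category. -/
def injectiveResolutionIso (K : DerivedCategory.Plus X.Modules) :
    DerivedCategory.Q.obj (injectiveResolution K).obj ≅ DerivedCategory.Plus.ι.obj K :=
  (DerivedCategory.quotientCompQhIso X.Modules).symm.app _ ≪≫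
    DerivedCategory.Plus.ι.mapIso (exists_injectiveResolution K).choose_spec.some

instance isKInjective_injectiveResolution (K : DerivedCategory.Plus X.Modules) :
    (injectiveResolution K).obj.IsKInjective :=
  inferInstanceAs (CochainComplex.IsKInjective
    (((InjectiveObject.ι X.Modules).mapHomologicalComplex (.up ℤ)).obj
      (exists_injectiveResolution K).choose.obj))

/-- The twist is the cone of an evaluation map. -/
def twistIso (K : DerivedCategory.Plus X.Modules) :
    DerivedCategory.Q.obj (CochainComplex.mappingCone
      (adjEval (tensorAdjunction f) (injectiveResolution K).obj)) ≅
      DerivedCategory.Plus.ι.obj (twist f K) :=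
  (DerivedCategory.quotientCompQhIso X.Modules).symm.app _

variable [Linear ℂ X.Modules] [(globalSections f).Linear ℂ]

/-- The sheaf `ℂ ⊗_ℂ 𝒪_X` represents the functor of global sections, so `Hom^P(𝒪_X, K)` consists of
the morphisms `𝒪_X[-P] ⟶ K` in the derived category. -/
theorem nonempty_derivedHom_linearEquiv_hyperext (K : DerivedCategory.Plus X.Modules) (P : ℤ) :
    Nonempty (((DerivedCategory.singleFunctor X.Modules P).obj (scalarSheaf f) ⟶
      DerivedCategory.Plus.ι.obj K) ≃ₗ[ℂ] (hyperext f K P : ModuleCat.{0} ℂ)) := by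
  obtain ⟨e⟩ := nonempty_derivedHom_linearEquiv_homology (scalarSheaf f)
    (injectiveResolution K).obj P (adjRepr (tensorAdjunction f)) (adjRepr_comp _)
  exact ⟨(Linear.homCongr ℂ (Iso.refl _) (injectiveResolutionIso K).symm).trans e⟩

theorem nonempty_derivedHom_linearEquiv_sheafCohomology (M : X.Modules) (n : ℕ) :
    Nonempty (((DerivedCategory.singleFunctor X.Modules n).obj (scalarSheaf f) ⟶
      (DerivedCategory.singleFunctor X.Modules 0).obj M) ≃ₗ[ℂ]
      ((sheafCohomology f n).obj M : ModuleCat.{0} ℂ)) :=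
  nonempty_derivedHom_linearEquiv_rightDerived (adjRepr (tensorAdjunction f)) (adjRepr_comp _) M n

/-- If the morphisms `𝒪_X[-n] ⟶ K` form a one-dimensional space for `n = P` and are zero otherwise,
then `T(K)` is the cone of a nonzero morphism `𝒪_X[-P] ⟶ K`. -/
theorem exists_distTriang_twist (K : DerivedCategory.Plus X.Modules) (P : ℤ)
    (h₀ : ∀ n, n ≠ P → ∀ φ : (DerivedCategory.singleFunctor X.Modules n).obj (scalarSheaf f) ⟶
      DerivedCategory.Plus.ι.obj K, φ = 0)
    (h₁ : Module.finrank ℂ ((DerivedCategory.singleFunctor X.Modules P).obj (scalarSheaf f) ⟶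
      DerivedCategory.Plus.ι.obj K) = 1) :
    ∃ (φ : (DerivedCategory.singleFunctor X.Modules P).obj (scalarSheaf f) ⟶
        DerivedCategory.Plus.ι.obj K)
      (g : DerivedCategory.Plus.ι.obj K ⟶ DerivedCategory.Plus.ι.obj (twist f K))
      (h : DerivedCategory.Plus.ι.obj (twist f K) ⟶
        ((DerivedCategory.singleFunctor X.Modules P).obj (scalarSheaf f))⟦(1 : ℤ)⟧),
      φ ≠ 0 ∧ Triangle.mk φ g h ∈ distTriang _ := by
  have h₀' : ∀ n, n ≠ P → IsZero (hyperext f K n) := by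
    intro n hn
    obtain ⟨e⟩ := nonempty_derivedHom_linearEquiv_hyperext f K n
    have : Subsingleton (hyperext f K n) :=
      ⟨fun x y => e.symm.injective ((h₀ n hn _).trans (h₀ n hn _).symm)⟩
    exact ModuleCat.isZero_of_subsingleton _
  have h₁' : Module.finrank ℂ (hyperext f K P) = 1 := by
    obtain ⟨e⟩ := nonempty_derivedHom_linearEquiv_hyperext f K P
    exact e.finrank_eq.symm.trans h₁
  obtain ⟨φ, g, h, hφ, hT⟩ := exists_distTriang_mappingCone_adjEval (tensorAdjunction f)
    (injectiveResolution K).obj P h₀' h₁'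
  refine ⟨φ ≫ (injectiveResolutionIso K).hom, (injectiveResolutionIso K).inv ≫ g ≫
    (twistIso f K).hom, (twistIso f K).inv ≫ h, ?_, isomorphic_distinguished _ hT _
      (Triangle.isoMk _ _ (Iso.refl _) (injectiveResolutionIso K).symm (twistIso f K).symm
        ?_ ?_ ?_)⟩
  · intro h'
    apply hφ
    rw [← cancel_mono (injectiveResolutionIso K).hom, h', zero_comp]
  · change (φ ≫ (injectiveResolutionIso K).hom) ≫ (injectiveResolutionIso K).inv = 𝟙 _ ≫ φ
    simp
  · change ((injectiveResolutionIso K).inv ≫ g ≫ (twistIso f K).hom) ≫ (twistIso f K).inv =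
      (injectiveResolutionIso K).inv ≫ g
    simp
  · change ((twistIso f K).inv ≫ h) ≫ (shiftFunctor _ (1 : ℤ)).map (𝟙 _) = (twistIso f K).inv ≫ h
    rw [CategoryTheory.Functor.map_id, Category.comp_id]

end

end CalabiYauTwist

/-! ### Two-term complexes -/

namespace CalabiYauTwist

open Pretriangulated

section

variable {C : Type*} [Category* C] [Abelian C] {M N : C} (φ : M ⟶ N)

/-- The inclusion of the kernel of `φ : M ⟶ N` in the two-term complex `M ⟶ N`. -/
def kernelToDouble : (HomologicalComplex.single C (.up ℤ) (-1)).obj (kernel φ) ⟶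
    HomologicalComplex.double φ (show (ComplexShape.up ℤ).Rel (-1) 0 by simp) :=
  HomologicalComplex.mkHomFromSingle
    (kernel.ι φ ≫ (HomologicalComplex.doubleXIso₀ φ _).inv) (by
      rintro m hm
      obtain rfl : m = 0 := by
        have : (-1 : ℤ) + 1 = m := hm
        lia
      rw [HomologicalComplex.double_d _ _ (by lia)]
      simp)

lemma kernelToDouble_f : (kernelToDouble φ).f (-1) =
    (HomologicalComplex.singleObjXSelf (.up ℤ) (-1) (kernel φ)).hom ≫
      kernel.ι φ ≫ (HomologicalComplex.doubleXIso₀ φ _).inv :=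
  HomologicalComplex.mkHomFromSingle_f _ _

lemma exact_kernelToDouble : (ShortComplex.mk ((kernelToDouble φ).f (-1))
    ((HomologicalComplex.double φ (show (ComplexShape.up ℤ).Rel (-1) 0 by simp)).d (-1) 0) (by
      rw [(kernelToDouble φ).comm, HomologicalComplex.single_obj_d, zero_comp])).Exact := by
  refine ShortComplex.exact_of_iso (S₁ := ShortComplex.mk (kernel.ι φ) φ (kernel.condition φ))
    (ShortComplex.isoMk (HomologicalComplex.singleObjXSelf (.up ℤ) (-1) (kernel φ)).symm
      (HomologicalComplex.doubleXIso₀ φ (show (ComplexShape.up ℤ).Rel (-1) 0 by simp)).symm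
      (HomologicalComplex.doubleXIso₁ φ (show (ComplexShape.up ℤ).Rel (-1) 0 by simp)
        (by lia)).symm ?_ ?_) (ShortComplex.exact_kernel φ)
  · exact (congrArg ((HomologicalComplex.singleObjXSelf (.up ℤ) (-1) (kernel φ)).inv ≫ ·)
      (kernelToDouble_f φ)).trans (Iso.inv_hom_id_assoc _ _)
  · exact (congrArg ((HomologicalComplex.doubleXIso₀ φ _).inv ≫ ·)
      (HomologicalComplex.double_d φ _ (by lia))).trans (Iso.inv_hom_id_assoc _ _)

lemma quasiIso_kernelToDouble [Epi φ] : QuasiIso (kernelToDouble φ) := by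
  let K := HomologicalComplex.double φ (show (ComplexShape.up ℤ).Rel (-1) 0 by simp)
  have hK : ∀ i, i ≠ -1 → i ≠ 0 → IsZero (K.X i) := fun i h h' =>
    HomologicalComplex.isZero_double_X _ _ _ h h'
  refine ⟨fun i => ?_⟩
  by_cases hi : i = -1
  · subst hi
    rw [quasiIsoAt_iff' _ (-2) (-1) 0 (by simp) (by simp),
      ShortComplex.quasiIso_iff_of_zeros]
    · constructor
      · exact exact_kernelToDouble φ
      · change Mono ((kernelToDouble φ).f (-1))
        rw [kernelToDouble_f]
        infer_instance
    · exact HomologicalComplex.single_obj_d (.up ℤ) (-1) (kernel φ) (-2) (-1)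
    · exact HomologicalComplex.single_obj_d (.up ℤ) (-1) (kernel φ) (-1) 0
    · exact (hK (-2) (by lia) (by lia)).eq_of_src _ _
  · rw [quasiIsoAt_iff_exactAt _ _
      (HomologicalComplex.exactAt_single_obj (.up ℤ) (-1) (kernel φ) i hi)]
    by_cases hi' : i = 0
    · subst hi'
      rw [HomologicalComplex.exactAt_iff' _ (-1) 0 1 (by simp) (by simp),
        ShortComplex.exact_iff_epi _ ((hK 1 (by lia) (by lia)).eq_of_tgt _ _)]
      change Epi (K.d (-1) 0)
      rw [HomologicalComplex.double_d _ _ (by lia)]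
      infer_instance
    · exact ShortComplex.exact_of_isZero_X₂ _ (hK i hi hi')

end

section

variable {X : Scheme.{0}} [HasDerivedCategory.{w} X.Modules]

/-- The shift of the bounded below derived category, computed in the derived category. -/
def ιShiftIso (K : DerivedCategory.Plus X.Modules) (n : ℤ) :
    DerivedCategory.Plus.ι.obj (K⟦n⟧) ≅ (DerivedCategory.Plus.ι.obj K)⟦n⟧ :=
  ((DerivedCategory.Plus.ι (C := X.Modules)).commShiftIso n).app K

/-- `M[n]` is the complex with `M` in degree `-n`. -/
def ιInDegreeZeroShiftIso (M : X.Modules) (n m : ℤ) (h : n + m = 0) :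
    DerivedCategory.Plus.ι.obj ((inDegreeZero M)⟦n⟧) ≅
      (DerivedCategory.singleFunctor X.Modules m).obj M :=
  ιShiftIso _ n ≪≫ ((DerivedCategory.singleFunctors X.Modules).shiftIso n m 0 h).app M

/-- The two-term complex given by an epimorphism is the shift of its kernel. -/
lemma nonempty_twoTermComplex_iso {M N : X.Modules} (φ : M ⟶ N) [Epi φ] :
    Nonempty (twoTermComplex φ ≅ (inDegreeZero (kernel φ))⟦(1 : ℤ)⟧) := by
  have := quasiIso_kernelToDouble φ
  let e : (DerivedCategory.singleFunctor X.Modules (-1)).obj (kernel φ) ≅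
      DerivedCategory.Q.obj (HomologicalComplex.double φ
        (show (ComplexShape.up ℤ).Rel (-1) 0 by simp)) :=
    @asIso _ _ _ _ (DerivedCategory.Q.map (kernelToDouble φ))
      ((DerivedCategory.isIso_Q_map_iff_quasiIso X.Modules (kernelToDouble φ)).2 this)
  exact ⟨DerivedCategory.Plus.ι.preimageIso
    ((DerivedCategory.quotientCompQhIso X.Modules).app _ ≪≫ e.symm ≪≫
      (ιInDegreeZeroShiftIso _ 1 (-1) (by lia)).symm)⟩

end

end CalabiYauTwist

/-! ### The twists of the skyscraper sheaf -/

namespace CalabiYauTwist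

open Pretriangulated

section

variable {X : Scheme.{0}} (f : X ⟶ Spec (CommRingCat.of ℂ))

variable (p : X)

/-- The cohomological input: the cohomology of `𝒪_X` is one-dimensional in degrees `0` and `3` and
zero otherwise, and the cohomology of `𝒪_p` is one-dimensional and concentrated in degree `0`. -/
structure CohomologyData : Prop where
  epi : Epi (evalAtPoint p)
  ne_zero : evalAtPoint p ≠ 0
  structureSheaf_iso : Nonempty (scalarSheaf f ≅ structureSheaf X)
  finrank_zero : Module.finrank ℂ ((sheafCohomology f 0).obj (structureSheaf X)) = 1
  finrank_three : Module.finrank ℂ ((sheafCohomology f 3).obj (structureSheaf X)) = 1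
  isZero : ∀ i, i ≠ 0 → i ≠ 3 → IsZero ((sheafCohomology f i).obj (structureSheaf X))
  finrank_skyscraper : Module.finrank ℂ ((sheafCohomology f 0).obj (skyscraper p)) = 1
  isZero_skyscraper : ∀ i, i ≠ 0 → IsZero ((sheafCohomology f i).obj (skyscraper p))

variable {f p}

/-- The short exact sequence `0 ⟶ I_p ⟶ 𝒪_X ⟶ 𝒪_p ⟶ 0`. -/
abbrev idealSequence (p : X) : ShortComplex X.Modules :=
  ShortComplex.mk (kernel.ι (evalAtPoint p)) (evalAtPoint p) (kernel.condition _)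

lemma idealSequence_shortExact [Epi (evalAtPoint p)] : (idealSequence p).ShortExact :=
  { exact := ShortComplex.exact_kernel _
    mono_f := inferInstanceAs (Mono (kernel.ι _))
    epi_g := ‹_› }

/-- The isomorphism `ℂ ⊗_ℂ 𝒪_X ≅ 𝒪_X` generates `H⁰(X, 𝒪_X)` and does not vanish at `p`. -/
lemma CohomologyData.exists_generator (H : CohomologyData f p) :
    ∃ x : scalarSheaf f ⟶ structureSheaf X, IsIso x ∧ x ≫ evalAtPoint p ≠ 0 := by
  obtain ⟨σ⟩ := H.structureSheaf_iso
  refine ⟨σ.hom, inferInstance, fun h => H.ne_zero ?_⟩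
  rw [← cancel_epi σ.hom, h, comp_zero]

variable [HasDerivedCategory.{w} X.Modules] [Linear ℂ X.Modules] [(globalSections f).Linear ℂ]

variable (f) in
lemma derivedHom_eq_zero_of_isZero_sheafCohomology (M : X.Modules) (n : ℤ)
    (h : ∀ i : ℕ, (i : ℤ) = n → IsZero ((sheafCohomology f i).obj M))
    (φ : (DerivedCategory.singleFunctor X.Modules n).obj (scalarSheaf f) ⟶
      (DerivedCategory.singleFunctor X.Modules 0).obj M) : φ = 0 := by
  rcases lt_or_ge n 0 with hn | hn
  · exact derivedHom_single_eq_zero_of_neg _ _ n hn φ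
  · obtain ⟨i, rfl⟩ := Int.eq_ofNat_of_zero_le hn
    obtain ⟨e⟩ := nonempty_derivedHom_linearEquiv_sheafCohomology f M i
    have := ModuleCat.subsingleton_of_isZero (h i rfl)
    exact e.injective (Subsingleton.elim _ _)

namespace CohomologyData

variable (H : CohomologyData f p)

include H

lemma derivedHom_skyscraper_eq_zero (n : ℤ) (hn : n ≠ 0)
    (φ : (DerivedCategory.singleFunctor X.Modules n).obj (scalarSheaf f) ⟶
      (DerivedCategory.singleFunctor X.Modules 0).obj (skyscraper p)) : φ = 0 :=
  derivedHom_eq_zero_of_isZero_sheafCohomology f _ n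
    (fun i hi => H.isZero_skyscraper i (by lia)) φ

lemma finrank_derivedHom_skyscraper : Module.finrank ℂ
    ((DerivedCategory.singleFunctor X.Modules 0).obj (scalarSheaf f) ⟶
      (DerivedCategory.singleFunctor X.Modules 0).obj (skyscraper p)) = 1 := by
  obtain ⟨e⟩ := nonempty_derivedHom_linearEquiv_sheafCohomology f (skyscraper p) 0
  exact e.finrank_eq.trans H.finrank_skyscraper

lemma derivedHom_structureSheaf_eq_zero (n : ℤ) (hn : n ≠ 0) (hn' : n ≠ 3)
    (φ : (DerivedCategory.singleFunctor X.Modules n).obj (scalarSheaf f) ⟶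
      (DerivedCategory.singleFunctor X.Modules 0).obj (structureSheaf X)) : φ = 0 :=
  derivedHom_eq_zero_of_isZero_sheafCohomology f _ n
    (fun i hi => H.isZero i (by lia) (by lia)) φ

lemma derivedHom_idealSheaf_eq_zero (n : ℤ) (hn : n ≠ 3)
    (φ : (DerivedCategory.singleFunctor X.Modules n).obj (scalarSheaf f) ⟶
      (DerivedCategory.singleFunctor X.Modules 0).obj (idealSheaf p)) : φ = 0 := by
  obtain ⟨x, -, hx⟩ := H.exists_generator
  have := H.epi
  by_cases hn₀ : n = 0
  · subst hn₀
    obtain ⟨e⟩ := nonempty_derivedHom_linearEquiv_sheafCohomology f (structureSheaf X) 0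
    exact derivedHom_kernel_zero ℂ (idealSequence_shortExact (p := p))
      (fun n hn φ => H.derivedHom_skyscraper_eq_zero n hn φ) H.finrank_derivedHom_skyscraper x hx
      (e.finrank_eq.trans H.finrank_zero) φ
  · exact derivedHom_kernel_injective ℂ (idealSequence_shortExact (p := p))
      (fun n hn φ => H.derivedHom_skyscraper_eq_zero n hn φ) H.finrank_derivedHom_skyscraper x hx
      n φ (H.derivedHom_structureSheaf_eq_zero n hn₀ hn _)

lemma finrank_derivedHom_idealSheaf : Module.finrank ℂ
    ((DerivedCategory.singleFunctor X.Modules 3).obj (scalarSheaf f) ⟶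
      (DerivedCategory.singleFunctor X.Modules 0).obj (idealSheaf p)) = 1 := by
  obtain ⟨x, -, hx⟩ := H.exists_generator
  have := H.epi
  obtain ⟨e⟩ := nonempty_derivedHom_linearEquiv_sheafCohomology f (structureSheaf X) 3
  rw [← H.finrank_three, ← e.finrank_eq]
  exact (LinearEquiv.ofBijective (Linear.rightComp ℂ _ _)
    (derivedHom_kernel_bijective ℂ (idealSequence_shortExact (p := p))
      (fun n hn φ => H.derivedHom_skyscraper_eq_zero n hn φ) H.finrank_derivedHom_skyscraper x hx
      3 (by lia))).finrank_eq

lemma isZero_sheafCohomology_idealSheaf (i : ℕ) (hi : i ≠ 3) :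
    IsZero ((sheafCohomology f i).obj (idealSheaf p)) := by
  obtain ⟨e⟩ := nonempty_derivedHom_linearEquiv_sheafCohomology f (idealSheaf p) i
  have : Subsingleton ((sheafCohomology f i).obj (idealSheaf p)) :=
    ⟨fun x y => e.symm.injective ((H.derivedHom_idealSheaf_eq_zero i (by lia) _).trans
      (H.derivedHom_idealSheaf_eq_zero i (by lia) _).symm)⟩
  exact ModuleCat.isZero_of_subsingleton _

lemma nonempty_sheafCohomology_idealSheaf_iso :
    Nonempty ((sheafCohomology f 3).obj (idealSheaf p) ≅ ModuleCat.of ℂ ℂ) := by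
  obtain ⟨e⟩ := nonempty_derivedHom_linearEquiv_sheafCohomology f (idealSheaf p) 3
  have h : Module.finrank ℂ ((sheafCohomology f 3).obj (idealSheaf p)) = Module.finrank ℂ ℂ := by
    rw [Module.finrank_self]
    exact e.finrank_eq.symm.trans H.finrank_derivedHom_idealSheaf
  have : Module.Finite ℂ ((sheafCohomology f 3).obj (idealSheaf p)) :=
    Module.finite_of_finrank_pos (by rw [h, Module.finrank_self]; exact one_pos)
  exact ⟨(LinearEquiv.ofFinrankEq _ _ h).toModuleIso⟩

lemma nonempty_twist_skyscraper_iso : Nonempty (twist f (inDegreeZero (skyscraper p)) ≅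
    (inDegreeZero (idealSheaf p))⟦(1 : ℤ)⟧) := by
  obtain ⟨x, _, hx⟩ := H.exists_generator
  have := H.epi
  obtain ⟨φ, g, h, hφ, hT⟩ := exists_distTriang_twist f (inDegreeZero (skyscraper p)) 0
    H.derivedHom_skyscraper_eq_zero H.finrank_derivedHom_skyscraper
  obtain ⟨e⟩ := nonempty_cone_iso_shift_kernel ℂ (idealSequence_shortExact (p := p))
    H.finrank_derivedHom_skyscraper x hx _ hT (Iso.refl _) (Iso.refl _) hφ
  exact ⟨DerivedCategory.Plus.ι.preimageIso (e ≪≫ (ιShiftIso (inDegreeZero (idealSheaf p)) 1).symm)⟩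

/-- `Hom(𝒪_X[-n], T(𝒪_p))` is the cohomology of `I_p` in degree `n + 1`. -/
lemma nonempty_derivedHom_twist_linearEquiv (n m : ℤ) (h : n + 1 = m) : Nonempty
    (((DerivedCategory.singleFunctor X.Modules m).obj (scalarSheaf f) ⟶
      (DerivedCategory.singleFunctor X.Modules 0).obj (idealSheaf p)) ≃ₗ[ℂ]
    ((DerivedCategory.singleFunctor X.Modules n).obj (scalarSheaf f) ⟶
      DerivedCategory.Plus.ι.obj (twist f (inDegreeZero (skyscraper p))))) := by
  obtain ⟨e⟩ := H.nonempty_twist_skyscraper_iso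
  exact ⟨(LinearEquiv.ofBijective _ (derivedHomShift_bijective ℂ (scalarSheaf f) _ n m h)).trans
    (Linear.homCongr ℂ (Iso.refl _) ((ιShiftIso (inDegreeZero (idealSheaf p)) 1).symm ≪≫
      DerivedCategory.Plus.ι.mapIso e.symm))⟩

/-- The space `Hom^n(𝒪_X, T(𝒪_p)) = H^{n+1}(X, I_p)` is one-dimensional for `n = 2` and zero
otherwise. -/
lemma exists_distTriang_twist_twist :
    ∃ (φ : (DerivedCategory.singleFunctor X.Modules 2).obj (scalarSheaf f) ⟶
        DerivedCategory.Plus.ι.obj (twist f (inDegreeZero (skyscraper p))))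
      (g : DerivedCategory.Plus.ι.obj (twist f (inDegreeZero (skyscraper p))) ⟶
        DerivedCategory.Plus.ι.obj (twist f (twist f (inDegreeZero (skyscraper p)))))
      (h : DerivedCategory.Plus.ι.obj (twist f (twist f (inDegreeZero (skyscraper p)))) ⟶
        ((DerivedCategory.singleFunctor X.Modules 2).obj (scalarSheaf f))⟦(1 : ℤ)⟧),
      φ ≠ 0 ∧ Triangle.mk φ g h ∈ distTriang _ := by
  refine exists_distTriang_twist f (twist f (inDegreeZero (skyscraper p))) 2 ?_ ?_
  · intro n hn φ
    obtain ⟨e⟩ := H.nonempty_derivedHom_twist_linearEquiv n (n + 1) rfl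
    obtain ⟨ψ, rfl⟩ := e.surjective φ
    rw [H.derivedHom_idealSheaf_eq_zero (n + 1) (by lia) ψ, map_zero]
  · obtain ⟨e⟩ := H.nonempty_derivedHom_twist_linearEquiv 2 3 rfl
    exact e.finrank_eq.symm.trans H.finrank_derivedHom_idealSheaf

/-- The object `T(𝒪_p)` is `I_p` in degree `-1`. -/
lemma nonempty_ι_twist_iso :
    Nonempty (DerivedCategory.Plus.ι.obj (twist f (inDegreeZero (skyscraper p))) ≅
      (DerivedCategory.singleFunctor X.Modules (-1)).obj (idealSheaf p)) := by
  obtain ⟨e⟩ := H.nonempty_twist_skyscraper_iso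
  exact ⟨DerivedCategory.Plus.ι.mapIso e ≪≫ ιInDegreeZeroShiftIso _ 1 (-1) (by lia)⟩

lemma exists_distTriang :
    ∃ (φ : (inDegreeZero (structureSheaf X))⟦(-2 : ℤ)⟧ ⟶ (inDegreeZero (idealSheaf p))⟦(1 : ℤ)⟧)
      (g : (inDegreeZero (idealSheaf p))⟦(1 : ℤ)⟧ ⟶
        twist f (twist f (inDegreeZero (skyscraper p))))
      (h : twist f (twist f (inDegreeZero (skyscraper p))) ⟶
        (inDegreeZero (structureSheaf X))⟦(-2 : ℤ)⟧⟦(1 : ℤ)⟧),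
      φ ≠ 0 ∧ Triangle.mk φ g h ∈ distTriang _ := by
  obtain ⟨σ⟩ := H.structureSheaf_iso
  obtain ⟨e⟩ := H.nonempty_twist_skyscraper_iso
  obtain ⟨φ, g, h, hφ, hT⟩ := H.exists_distTriang_twist_twist
  exact exists_distTriang_plus hT
    (ιInDegreeZeroShiftIso _ (-2) 2 (by lia) ≪≫
      (DerivedCategory.singleFunctor X.Modules 2).mapIso σ.symm)
    (DerivedCategory.Plus.ι.mapIso e.symm) (Iso.refl _) hφ

lemma nonempty_homology_neg_one : Nonempty (
    (DerivedCategory.Plus.homologyFunctor X.Modules (-1)).obj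
    (twist f (twist f (inDegreeZero (skyscraper p)))) ≅ idealSheaf p) := by
  obtain ⟨φ, g, h, hφ, hT⟩ := H.exists_distTriang_twist_twist
  obtain ⟨e⟩ := H.nonempty_ι_twist_iso
  exact nonempty_homology_cone_iso_neg_one _ hT (Iso.refl _) e

lemma nonempty_homology_one : Nonempty ((DerivedCategory.Plus.homologyFunctor X.Modules 1).obj
    (twist f (twist f (inDegreeZero (skyscraper p)))) ≅ structureSheaf X) := by
  obtain ⟨σ⟩ := H.structureSheaf_iso
  obtain ⟨φ, g, h, hφ, hT⟩ := H.exists_distTriang_twist_twist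
  obtain ⟨e⟩ := H.nonempty_ι_twist_iso
  exact nonempty_homology_cone_iso_one _ hT
    ((DerivedCategory.singleFunctor X.Modules 2).mapIso σ) e

lemma isZero_homology (n : ℤ) (hn : n ≠ -1) (hn' : n ≠ 1) :
    IsZero ((DerivedCategory.Plus.homologyFunctor X.Modules n).obj
      (twist f (twist f (inDegreeZero (skyscraper p))))) := by
  obtain ⟨φ, g, h, hφ, hT⟩ := H.exists_distTriang_twist_twist
  obtain ⟨e⟩ := H.nonempty_ι_twist_iso
  exact isZero_homology_cone _ hT (Iso.refl _) e n hn hn'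

/-- The vector space `Hom²(𝒪_X, T(T(𝒪_p)))` is zero, while `Hom²(𝒪_X, I_p[1]) = H³(X, I_p)` is
not. -/
lemma not_nonempty_hyperext_iso : ¬ Nonempty
    (hyperext f (twist f (twist f (inDegreeZero (skyscraper p)))) 2 ≅
      hyperext f ((inDegreeZero (idealSheaf p))⟦(1 : ℤ)⟧ ⊞
        (inDegreeZero (structureSheaf X))⟦(-1 : ℤ)⟧) 2) := by
  rintro ⟨e⟩
  obtain ⟨σ⟩ := H.structureSheaf_iso
  obtain ⟨φ, g, h, hφ, hT⟩ := H.exists_distTriang_twist_twist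
  obtain ⟨i⟩ := H.nonempty_twist_skyscraper_iso
  obtain ⟨e₁⟩ := nonempty_derivedHom_linearEquiv_hyperext f
    (twist f (twist f (inDegreeZero (skyscraper p)))) 2
  obtain ⟨e₂⟩ := nonempty_derivedHom_linearEquiv_hyperext f
    ((inDegreeZero (idealSheaf p))⟦(1 : ℤ)⟧ ⊞ (inDegreeZero (structureSheaf X))⟦(-1 : ℤ)⟧) 2
  obtain ⟨e₃⟩ := H.nonempty_derivedHom_twist_linearEquiv 2 3 rfl
  -- `Hom(𝒪_X[-2], 𝒪_X[-1]) = H¹(X, 𝒪_X)` vanishes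
  have h₁ : ∀ ψ : (DerivedCategory.singleFunctor X.Modules 2).obj (scalarSheaf f) ⟶
      ((DerivedCategory.singleFunctor X.Modules 2).obj (scalarSheaf f))⟦(1 : ℤ)⟧, ψ = 0 := by
    intro ψ
    rw [← cancel_mono (((DerivedCategory.singleFunctors X.Modules).shiftIso 1 1 2 rfl).hom.app
      (scalarSheaf f)), zero_comp]
    refine derivedHom_single_eq_zero_of_succ ℂ _ _ 1 2 0 1 rfl rfl (fun χ => ?_) _
    rw [← cancel_mono ((DerivedCategory.singleFunctor X.Modules 0).map σ.hom), zero_comp]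
    exact H.derivedHom_structureSheaf_eq_zero 1 (by lia) (by lia) _
  have h₂ := derivedHom_cone_eq_zero (k := ℂ) _ hT 2 rfl h₁
    (e₃.finrank_eq.symm.trans H.finrank_derivedHom_idealSheaf) hφ
  let r : DerivedCategory.Plus.ι.obj (twist f (inDegreeZero (skyscraper p))) ⟶
      DerivedCategory.Plus.ι.obj ((inDegreeZero (idealSheaf p))⟦(1 : ℤ)⟧ ⊞
        (inDegreeZero (structureSheaf X))⟦(-1 : ℤ)⟧) :=
    DerivedCategory.Plus.ι.map (i.hom ≫ biprod.inl)
  have hr : r ≫ DerivedCategory.Plus.ι.map (biprod.fst ≫ i.inv) = 𝟙 _ := by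
    rw [← Functor.map_comp, Category.assoc, biprod.inl_fst_assoc, Iso.hom_inv_id,
      CategoryTheory.Functor.map_id]
  let e₄ := e₁.trans (e.toLinearEquiv.trans e₂.symm)
  obtain ⟨ψ, hψ⟩ := e₄.surjective (φ ≫ r)
  have hφr : φ ≫ r = 0 := hψ.symm.trans ((congrArg e₄ (h₂ ψ)).trans (map_zero e₄))
  apply hφ
  rw [← Category.comp_id φ, ← hr, ← Category.assoc, hφr, zero_comp]

end CohomologyData

variable (f) in
lemma nonempty_hyperext_iso {K L : DerivedCategory.Plus X.Modules} (e : K ≅ L) (P : ℤ) :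
    Nonempty (hyperext f K P ≅ hyperext f L P) := by
  obtain ⟨e₁⟩ := nonempty_derivedHom_linearEquiv_hyperext f K P
  obtain ⟨e₂⟩ := nonempty_derivedHom_linearEquiv_hyperext f L P
  exact ⟨(e₁.symm.trans ((Linear.homCongr ℂ (Iso.refl _)
    (DerivedCategory.Plus.ι.mapIso e)).trans e₂)).toModuleIso⟩

end

end CalabiYauTwist

/-! ### The cohomology of a Calabi–Yau threefold -/

namespace CalabiYauTwist

lemma IsCalabiYauThreefold.cohomologyData {X : Scheme.{0}} {f : X ⟶ Spec (CommRingCat.of ℂ)}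
    (hX : IsCalabiYauThreefold f) (p : X) (hp : IsClosed {p}) : CohomologyData f p := by
  have := hX.isIntegral
  have := hX.isProper
  obtain ⟨ω, t, hω, ⟨e⟩⟩ := hX.trivial_canonical
  exact
    { epi := epi_evalAtPoint p hp
      ne_zero := evalAtPoint_ne_zero p
      structureSheaf_iso := nonempty_tensorStructureSheaf_iso f
      finrank_zero := (finrank_sheafCohomology_zero f _).trans
        (finrank_globalSections_structureSheaf f)
      finrank_three := hω.finrank_eq_one e
      isZero := fun i h₀ h₃ => by
        obtain rfl | rfl | h : i = 1 ∨ i = 2 ∨ 3 < i := by lia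
        · exact hX.isZero_H1
        · exact hX.isZero_H2
        · exact hX.isZero_sheafCohomology _ i h
      finrank_skyscraper := (finrank_sheafCohomology_zero f _).trans
        (finrank_globalSections_skyscraper p f hp)
      isZero_skyscraper := fun i hi =>
        (isFlasqueModule_skyscraper p).isZero_sheafCohomology f i hi }

end CalabiYauTwist

end

open CalabiYauTwist in
theorem mainTheorem2 {X : Scheme.{0}} (f : X ⟶ Spec (CommRingCat.of ℂ))
    (hX : IsCalabiYauThreefold f) (p : X) (hp : IsClosed {p})
    [HasDerivedCategory.{w} X.Modules] :
    -- `T(𝒪_p)` is the complex `𝒪_X ⟶ 𝒪_p`, which is quasi-isomorphic to `I_p[1]`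
    Nonempty (twist f (inDegreeZero (skyscraper p)) ≅ twoTermComplex (evalAtPoint p)) ∧
    Nonempty (twist f (inDegreeZero (skyscraper p)) ≅ (inDegreeZero (idealSheaf p))⟦(1 : ℤ)⟧) ∧
    -- `H³(X, I_p) = ℂ` and the other cohomology groups of `I_p` vanish
    Nonempty ((sheafCohomology f 3).obj (idealSheaf p) ≅ ModuleCat.of ℂ ℂ) ∧
    (∀ i : ℕ, i ≠ 3 → IsZero ((sheafCohomology f i).obj (idealSheaf p))) ∧
    -- `T(T(𝒪_p))` is the cone of a nonzero morphism `𝒪_X[-2] ⟶ I_p[1]`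
    (∃ (φ : (inDegreeZero (structureSheaf X))⟦(-2 : ℤ)⟧ ⟶ (inDegreeZero (idealSheaf p))⟦(1 : ℤ)⟧)
      (g : (inDegreeZero (idealSheaf p))⟦(1 : ℤ)⟧ ⟶
        twist f (twist f (inDegreeZero (skyscraper p))))
      (h : twist f (twist f (inDegreeZero (skyscraper p))) ⟶
        (inDegreeZero (structureSheaf X))⟦(-2 : ℤ)⟧⟦(1 : ℤ)⟧),
      φ ≠ 0 ∧ Pretriangulated.Triangle.mk φ g h ∈ distTriang _) ∧
    -- the cohomology sheaves of `T(T(𝒪_p))`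
    Nonempty ((DerivedCategory.Plus.homologyFunctor X.Modules (-1)).obj
      (twist f (twist f (inDegreeZero (skyscraper p)))) ≅ idealSheaf p) ∧
    Nonempty ((DerivedCategory.Plus.homologyFunctor X.Modules 1).obj
      (twist f (twist f (inDegreeZero (skyscraper p)))) ≅ structureSheaf X) ∧
    (∀ n : ℤ, n ≠ -1 → n ≠ 1 → IsZero ((DerivedCategory.Plus.homologyFunctor X.Modules n).obj
      (twist f (twist f (inDegreeZero (skyscraper p)))))) ∧
    -- the groups `Hom^P(𝒪_X, -)` distinguish `T(T(𝒪_p))` from `I_p[1] ⊕ 𝒪_X[-1]`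
    (∃ P : ℤ, ¬ Nonempty (hyperext f (twist f (twist f (inDegreeZero (skyscraper p)))) P ≅
      hyperext f ((inDegreeZero (idealSheaf p))⟦(1 : ℤ)⟧ ⊞
        (inDegreeZero (structureSheaf X))⟦(-1 : ℤ)⟧) P)) ∧
    -- `T(T(𝒪_p))` is not quasi-isomorphic to `I_p[1] ⊕ 𝒪_X[-1]`
    ¬ Nonempty (twist f (twist f (inDegreeZero (skyscraper p))) ≅
      (inDegreeZero (idealSheaf p))⟦(1 : ℤ)⟧ ⊞ (inDegreeZero (structureSheaf X))⟦(-1 : ℤ)⟧) := by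
  let := linearModules f
  have := globalSections_linear f
  have H := hX.cohomologyData p hp
  obtain ⟨e⟩ := H.nonempty_twist_skyscraper_iso
  have := H.epi
  obtain ⟨e'⟩ := nonempty_twoTermComplex_iso (evalAtPoint p)
  exact ⟨⟨e ≪≫ e'.symm⟩, ⟨e⟩, H.nonempty_sheafCohomology_idealSheaf_iso,
    H.isZero_sheafCohomology_idealSheaf, H.exists_distTriang, H.nonempty_homology_neg_one,
    H.nonempty_homology_one, H.isZero_homology, ⟨2, H.not_nonempty_hyperext_iso⟩,
    fun ⟨i⟩ => H.not_nonempty_hyperext_iso (nonempty_hyperext_iso f i 2)⟩
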